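/- Let $R=\prod_{i\in\mathbb N}\mathbb Z/2$, let $R_j=\{(x_i)_i\in R : x_i=0 \text{ for all } i\neq j\}$ for $j\in\mathbb N$, and let $I=\bigoplus_{j}R_j\subseteq R$. For an $R$-module $M$ let $\mathrm{Gen}(M)$ be the class of all quotients of coproducts of copies of $M$. Then $(\mathrm{Gen}(I),\mathrm{Gen}(R/I))$ is a torsion pair in $\mathrm{Mod}(R)$. Let $\mathcal D=\mathcal D(R)$ be the derived category of $\mathrm{Mod}(R)$, with suspension $\Sigma$. By Happel–Reiten–Smalø tilting there is a $t$-structure $\mathbf x=(\mathcal U,\mathcal W)$ in $\mathcal D$ with $$\mathcal U=\{X : H^n(X)=0\ \forall n>0,\ H^0(X)\in\mathrm{Gen}(I)\},\qquad \mathcal W=\{X : H^n(X)=0\ \forall n<-1,\ H^{-1}(X)\in\mathrm{Gen}(R/I)\}.$$ Let $\mathcal H_{\mathbf x}=\mathcal U\cap\mathcal W$ be its heart and let $\mathcal C_{\mathbf x}=\mathcal H_{\mathbf x}\star\Sigma^{-1}\mathcal H_{\mathbf x}$ be its extended heart, that is, the class of all $X$ in a distinguished triangle $H\to X\to H'\to\Sigma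 H$ with $H\in\mathcal H_{\mathbf x}$ and $H'\in\Sigma^{-1}\mathcal H_{\mathbf x}$. A full subcategory of $\mathcal D$ that contains $0$ and is closed under isomorphisms and extensions is regarded as an extriangulated category (in the sense of Nakaoka and Palu) with $\mathbb E(B,A)=\mathrm{Hom}_{\mathcal D}(B,\Sigma A)$, where $\delta\in\mathbb E(B,A)$ is realized by the sequences $A\to Z\to B$ for which $A\to Z\to B\xrightarrow{\delta}\Sigma A$ is a distinguished triangle. An extriangulated category $(\mathcal C,\mathbb E,\mathfrak s)$ is *AET4* if, for every non-empty set $J$, coproducts indexed by $J$ exist in $\mathcal C$ and there are group homomorphisms $$\Gamma_{B,A}:\prod_{j\in J}\mathbb E(B_j,A)\to\mathbb E\Big(\coprod_{j\in J} B_j,\ A^{(J)}\Big),$$ natural in the family $B=(B_j)_{j\in J}$ and in $A$, where $A^{(J)}$ is the coproduct of $J$ copies of $A$, such that for every $\eta=(\eta_j)_{j\in J}$: 1. if $\eta_j$ is realized by $A\xrightarrow{x_j}Z_j\xrightarrow{y_j}B_j$ for each $j\in J$, then $\Gamma_{B,A}(\eta)$ is realized by $A^{(J)}\xrightarrow{\coprod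 x_j}\coprod Z_j\xrightarrow{\coprod y_j}\coprod B_j$; 2. $\Gamma_{B,A}(\eta)\cdot\mu^B_j=\mu^A_j\cdot\eta_j$ in $\mathbb E(B_j,A^{(J)})$ for each $j\in J$, where $\mu^B_j:B_j\to\coprod B_j$ and $\mu^A_j:A\to A^{(J)}$ are the canonical inclusions. It is *AET4\** if its opposite extriangulated category is AET4. The $t$-structure $\mathbf x$ is *co-smashing* if the class of all products in $\mathcal D$ of set-indexed families of objects of $\mathcal U$ equals $\mathcal U$. Then: - $\mathcal H_{\mathbf x}$ is AET4\*, but $\mathbf x$ is not co-smashing; - $\mathcal C_{\mathbf x}=\mathcal W\cap\Sigma^{-1}\mathcal U$, and $\mathcal C_{\mathbf x}$ is not AET4\*. In particular $\mathcal C_{\mathbf x}=\mathcal H_{\mathbf x}\star\Sigma^{-1}\mathcal H_{\mathbf x}$ is not AET4\* although both $\mathcal H_{\mathbf x}$ and $\Sigma^{-1}\mathcal H_{\mathbf x}$ are AET4\*. -/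

import Mathlib

open CategoryTheory CategoryTheory.Limits CategoryTheory.Pretriangulated
  CategoryTheory.Triangulated Opposite

universe t w v u

/-- The (external) direct sum of two morphisms, along bicones of their sources and targets. -/
def CategoryTheory.Limits.BinaryBicone.mapHom {C : Type u} [Category.{v} C] [Preadditive C]
    {A A' B B' : C} (a : BinaryBicone A A') (b : BinaryBicone B B')
    (f : A ⟶ B) (f' : A' ⟶ B') : a.pt ⟶ b.pt :=
  a.fst ≫ f ≫ b.inl + a.snd ≫ f' ≫ b.inr

/-- The bicone in `C` corresponding to a bicone in `Cᵒᵖ`. -/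
def CategoryTheory.Limits.BinaryBicone.unopBicone {C : Type u} [Category.{v} C] [Preadditive C]
    {A A' : Cᵒᵖ} (b : BinaryBicone A A') : BinaryBicone A.unop A'.unop where
  pt := b.pt.unop
  fst := b.inl.unop
  snd := b.inr.unop
  inl := b.fst.unop
  inr := b.snd.unop
  inl_fst := Quiver.Hom.op_inj b.inl_fst
  inl_snd := Quiver.Hom.op_inj b.inr_fst
  inr_fst := Quiver.Hom.op_inj b.inl_snd
  inr_snd := Quiver.Hom.op_inj b.inr_snd

/-- An extriangulated structure `(𝔼, 𝔰)` on an additive category `C`, in the sense of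
Nakaoka and Palu.

* `E X Y` is the group `𝔼(X, Y)` (contravariant in `X`, covariant in `Y`); for `δ : E X Y`,
  `pull f δ` is `δ · f` and `push g δ` is `g · δ`.
* `Realizes δ x y` says that the sequence `Y --x--> Z --y--> X` belongs to the equivalence
  class `𝔰(δ)`. -/
structure Extriangulated (C : Type u) [Category.{v} C] [Preadditive C] [HasZeroObject C]
    [HasBinaryBiproducts C] where
  E : C → C → Type w
  [addCommGroup (X Y : C) : AddCommGroup (E X Y)]
  pull {X X' : C} (f : X' ⟶ X) (Y : C) : E X Y →+ E X' Y
  push (X : C) {Y Y' : C} (g : Y ⟶ Y') : E X Y →+ E X Y'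
  -- (ET1) `E` is an additive bifunctor `Cᵒᵖ × C ⥤ Ab`
  pull_id {X Y : C} (δ : E X Y) : pull (𝟙 X) Y δ = δ
  pull_comp {X X' X'' Y : C} (f' : X'' ⟶ X') (f : X' ⟶ X) (δ : E X Y) :
    pull (f' ≫ f) Y δ = pull f' Y (pull f Y δ)
  push_id {X Y : C} (δ : E X Y) : push X (𝟙 Y) δ = δ
  push_comp {X Y Y' Y'' : C} (g : Y ⟶ Y') (g' : Y' ⟶ Y'') (δ : E X Y) :
    push X (g ≫ g') δ = push X g' (push X g δ)
  pull_push {X X' Y Y' : C} (f : X' ⟶ X) (g : Y ⟶ Y') (δ : E X Y) :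
    pull f Y' (push X g δ) = push X' g (pull f Y δ)
  pull_add {X X' Y : C} (f f' : X' ⟶ X) (δ : E X Y) :
    pull (f + f') Y δ = pull f Y δ + pull f' Y δ
  push_add {X Y Y' : C} (g g' : Y ⟶ Y') (δ : E X Y) :
    push X (g + g') δ = push X g δ + push X g' δ
  /-- the realization `𝔰` -/
  Realizes {X Y Z : C} (δ : E X Y) (x : Y ⟶ Z) (y : Z ⟶ X) : Prop
  -- `𝔰(δ)` is exactly one equivalence class of sequences
  exists_realizes {X Y : C} (δ : E X Y) :
    ∃ (Z : C) (x : Y ⟶ Z) (y : Z ⟶ X), Realizes δ x y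
  realizes_iff {X Y Z Z' : C} {δ : E X Y} {x : Y ⟶ Z} {y : Z ⟶ X} (h : Realizes δ x y)
    (x' : Y ⟶ Z') (y' : Z' ⟶ X) :
    Realizes δ x' y' ↔ ∃ e : Z ≅ Z', x ≫ e.hom = x' ∧ e.hom ≫ y' = y
  -- (ET2) `𝔰` is an additive realization
  exists_middle {X Y Z X' Y' Z' : C} {δ : E X Y} {x : Y ⟶ Z} {y : Z ⟶ X}
    {δ' : E X' Y'} {x' : Y' ⟶ Z'} {y' : Z' ⟶ X'} (h : Realizes δ x y) (h' : Realizes δ' x' y')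
    (g : Y ⟶ Y') (f : X ⟶ X') (hfg : push X g δ = pull f Y' δ') :
    ∃ b : Z ⟶ Z', x ≫ b = g ≫ x' ∧ y ≫ f = b ≫ y'
  realizes_zero {X Y : C} (b : BinaryBicone Y X) (_ : b.IsBilimit) :
    Realizes (0 : E X Y) b.inl b.snd
  realizes_sum {X Y Z X' Y' Z' : C} {δ : E X Y} {x : Y ⟶ Z} {y : Z ⟶ X}
    {δ' : E X' Y'} {x' : Y' ⟶ Z'} {y' : Z' ⟶ X'} (h : Realizes δ x y) (h' : Realizes δ' x' y')
    (bX : BinaryBicone X X') (bY : BinaryBicone Y Y') (bZ : BinaryBicone Z Z')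
    (_ : bX.IsBilimit) (_ : bY.IsBilimit) (_ : bZ.IsBilimit) :
    Realizes (pull bX.fst _ (push X bY.inl δ) + pull bX.snd _ (push X' bY.inr δ'))
      (bY.mapHom bZ x x') (bZ.mapHom bX y y')
  -- (ET3) and its dual
  et3 {X Y Z X' Y' Z' : C} {δ : E X Y} {x : Y ⟶ Z} {y : Z ⟶ X}
    {δ' : E X' Y'} {x' : Y' ⟶ Z'} {y' : Z' ⟶ X'} (h : Realizes δ x y) (h' : Realizes δ' x' y')
    (g : Y ⟶ Y') (b : Z ⟶ Z') (hgb : x ≫ b = g ≫ x') :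
    ∃ f : X ⟶ X', y ≫ f = b ≫ y' ∧ push X g δ = pull f Y' δ'
  et3_op {X Y Z X' Y' Z' : C} {δ : E X Y} {x : Y ⟶ Z} {y : Z ⟶ X}
    {δ' : E X' Y'} {x' : Y' ⟶ Z'} {y' : Z' ⟶ X'} (h : Realizes δ x y) (h' : Realizes δ' x' y')
    (b : Z ⟶ Z') (f : X ⟶ X') (hbf : y ≫ f = b ≫ y') :
    ∃ g : Y ⟶ Y', x ≫ b = g ≫ x' ∧ push X g δ = pull f Y' δ'
  -- (ET4) and its dual
  et4 {A B C' D F : C} {δ : E D A} {f : A ⟶ B} {f' : B ⟶ D} {δ' : E F B} {g : B ⟶ C'}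
    {g' : C' ⟶ F} (h : Realizes δ f f') (h' : Realizes δ' g g') :
    ∃ (G : C) (d : D ⟶ G) (e : G ⟶ F) (k : C' ⟶ G) (δ'' : E G A),
      Realizes δ'' (f ≫ g) k ∧ f' ≫ d = g ≫ k ∧ k ≫ e = g' ∧
      Realizes (push F f' δ') d e ∧ pull d A δ'' = δ ∧ push G f δ'' = pull e B δ'
  et4_op {A B C' D F : C} {δ : E B D} {f' : D ⟶ A} {f : A ⟶ B} {δ' : E C' F} {g' : F ⟶ B}
    {g : B ⟶ C'} (h : Realizes δ f' f) (h' : Realizes δ' g' g) :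
    ∃ (G : C) (d : D ⟶ G) (e : G ⟶ F) (k : G ⟶ A) (δ'' : E C' G),
      Realizes δ'' k (f ≫ g) ∧ d ≫ k = f' ∧ k ≫ f = e ≫ g' ∧
      Realizes (pull g' D δ) d e ∧ push C' e δ'' = δ' ∧ push B d δ = pull g G δ''

attribute [instance] Extriangulated.addCommGroup

namespace Extriangulated

variable {C : Type u} [Category.{v} C] [Preadditive C] [HasZeroObject C] [HasBinaryBiproducts C]

/-- The opposite extriangulated structure on `Cᵒᵖ`. -/
def opposite (S : Extriangulated.{w} C) : Extriangulated.{w} Cᵒᵖ where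
  E X Y := S.E Y.unop X.unop
  pull f Y := S.push Y.unop f.unop
  push X _ _ g := S.pull g.unop X.unop
  pull_id δ := S.push_id δ
  pull_comp f' f δ := S.push_comp f.unop f'.unop δ
  push_id δ := S.pull_id δ
  push_comp g g' δ := S.pull_comp g'.unop g.unop δ
  pull_push f g δ := (S.pull_push g.unop f.unop δ).symm
  pull_add f f' δ := S.push_add f.unop f'.unop δ
  push_add g g' δ := S.pull_add g.unop g'.unop δ
  Realizes δ x y := S.Realizes δ y.unop x.unop
  exists_realizes δ := by
    obtain ⟨Z, x, y, h⟩ := S.exists_realizes δ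
    exact ⟨op Z, y.op, x.op, h⟩
  realizes_iff h x' y' := by
    rw [S.realizes_iff h]
    constructor
    · rintro ⟨e, h₁, h₂⟩
      refine ⟨e.symm.op, ?_, ?_⟩
      · apply Quiver.Hom.unop_inj
        simp [← h₂]
      · apply Quiver.Hom.unop_inj
        simp [← h₁]
    · rintro ⟨e, h₁, h₂⟩
      refine ⟨e.symm.unop, ?_, ?_⟩
      · apply Quiver.Hom.op_inj
        simp [← h₂]
      · apply Quiver.Hom.op_inj
        simp [← h₁]
  exists_middle h h' g f hfg := by
    obtain ⟨b, h₁, h₂⟩ := S.exists_middle h' h f.unop g.unop hfg.symm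
    exact ⟨b.op, Quiver.Hom.unop_inj h₂.symm, Quiver.Hom.unop_inj h₁.symm⟩
  realizes_zero {X Y} b hb := by
    have ht := congrArg Quiver.Hom.unop (IsBilimit.binary_total hb)
    let b' : BinaryBicone X.unop Y.unop :=
      { pt := b.pt.unop
        fst := b.inr.unop
        snd := b.inl.unop
        inl := b.snd.unop
        inr := b.fst.unop
        inl_fst := Quiver.Hom.op_inj b.inr_snd
        inl_snd := Quiver.Hom.op_inj b.inl_snd
        inr_fst := Quiver.Hom.op_inj b.inr_fst
        inr_snd := Quiver.Hom.op_inj b.inl_fst }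
    exact S.realizes_zero b' (isBinaryBilimitOfTotal b' (by
      rw [add_comm]; exact ht))
  realizes_sum {X Y Z X' Y' Z' δ x y δ' x' y'} h h' bX bY bZ hX hY hZ := by
    have key := S.realizes_sum h h' bY.unopBicone bX.unopBicone bZ.unopBicone
      (isBinaryBilimitOfTotal _ (congrArg Quiver.Hom.unop (IsBilimit.binary_total hY)))
      (isBinaryBilimitOfTotal _ (congrArg Quiver.Hom.unop (IsBilimit.binary_total hX)))
      (isBinaryBilimitOfTotal _ (congrArg Quiver.Hom.unop (IsBilimit.binary_total hZ)))
    have e₁ : bX.unopBicone.mapHom bZ.unopBicone y.unop y'.unop = (bZ.mapHom bX y y').unop := by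
      simp [BinaryBicone.mapHom, BinaryBicone.unopBicone]
      rfl
    have e₂ : bZ.unopBicone.mapHom bY.unopBicone x.unop x'.unop = (bY.mapHom bZ x x').unop := by
      simp [BinaryBicone.mapHom, BinaryBicone.unopBicone]
      rfl
    rw [e₁, e₂, S.pull_push, S.pull_push] at key
    exact key
  et3 h h' g b hgb := by
    obtain ⟨f, h₁, h₂⟩ := S.et3_op h' h b.unop g.unop (congrArg Quiver.Hom.unop hgb).symm
    exact ⟨f.op, Quiver.Hom.unop_inj h₁.symm, h₂.symm⟩
  et3_op h h' b f hbf := by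
    obtain ⟨g, h₁, h₂⟩ := S.et3 h' h f.unop b.unop (congrArg Quiver.Hom.unop hbf).symm
    exact ⟨g.op, Quiver.Hom.unop_inj h₁.symm, h₂.symm⟩
  et4 h h' := by
    obtain ⟨G, d, e, k, δ'', h₁, h₂, h₃, h₄, h₅, h₆⟩ := S.et4_op h' h
    exact ⟨op G, e.op, d.op, k.op, δ'', h₁, Quiver.Hom.unop_inj h₃.symm,
      Quiver.Hom.unop_inj h₂, h₄, h₅, h₆.symm⟩
  et4_op h h' := by
    obtain ⟨G, d, e, k, δ'', h₁, h₂, h₃, h₄, h₅, h₆⟩ := S.et4 h' h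
    exact ⟨op G, e.op, d.op, k.op, δ'', h₁, Quiver.Hom.unop_inj h₃,
      Quiver.Hom.unop_inj h₂.symm, h₄, h₅, h₆.symm⟩

/-- `C` is AET4: for every non-empty set `I`, coproducts indexed by `I` exist in `C`, the coproduct
functor `Fun(I, C) ⥤ C` is `(1, T)`-extriangulated via some natural transformation `Γ`, where
`T : C ⥤ Fun(I, C)` is the constant functor, and so is the family of coproduct inclusions. -/
def IsAET4 (S : Extriangulated.{w} C) : Prop :=
  ∀ (I : Type t) [Nonempty I], ∃ _ : HasCoproductsOfShape I C,
    ∃ Γ : ∀ (B : I → C) (A : C), (∀ i, S.E (B i) A) →+ S.E (∐ B) (∐ fun _ : I => A),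
      -- `Γ` is natural
      (∀ (B B' : I → C) (A A' : C) (f : ∀ i, B' i ⟶ B i) (a : A ⟶ A') (η : ∀ i, S.E (B i) A),
        Γ B' A' (fun i => S.pull (f i) A' (S.push (B i) a (η i))) =
          S.pull (Limits.Sigma.map f) _ (S.push (∐ B) (Limits.Sigma.map fun _ => a) (Γ B A η))) ∧
      -- coproducts are extriangulated
      (∀ (B : I → C) (A : C) (η : ∀ i, S.E (B i) A) (Z : I → C) (x : ∀ i, A ⟶ Z i)
        (y : ∀ i, Z i ⟶ B i), (∀ i, S.Realizes (η i) (x i) (y i)) →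
          S.Realizes (Γ B A η) (Limits.Sigma.map x) (Limits.Sigma.map y)) ∧
      -- coproduct inclusions are extriangulated
      (∀ (B : I → C) (A : C) (η : ∀ i, S.E (B i) A) (i : I),
        S.pull (Limits.Sigma.ι B i) _ (Γ B A η) =
          S.push (B i) (Limits.Sigma.ι (fun _ : I => A) i) (η i))

/-- `C` is AET4* if `Cᵒᵖ` is AET4. -/
def IsAET4Star (S : Extriangulated.{w} C) : Prop :=
  IsAET4.{t} S.opposite

end Extriangulated

section ExtensionClosed

open scoped ZeroObject

variable {D : Type u} [Category.{v} D] [Preadditive D] [HasZeroObject D] [HasShift D ℤ]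
  [∀ n : ℤ, (shiftFunctor D n).Additive] [Pretriangulated D]

lemma CategoryTheory.Pretriangulated.distinguished_of_biproduct {T₁ T₂ T : Triangle D}
    (h₁ : T₁ ∈ distTriang D) (h₂ : T₂ ∈ distTriang D) (p₁ : T ⟶ T₁) (p₂ : T ⟶ T₂)
    (i₁ : T₁ ⟶ T) (i₂ : T₂ ⟶ T) (h₁₁ : i₁ ≫ p₁ = 𝟙 _) (h₁₂ : i₁ ≫ p₂ = 0) (h₂₁ : i₂ ≫ p₁ = 0)
    (h₂₂ : i₂ ≫ p₂ = 𝟙 _) (tot : p₁ ≫ i₁ + p₂ ≫ i₂ = 𝟙 _) : T ∈ distTriang D := by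
  let F : Bool → Triangle D := fun b => bif b then T₁ else T₂
  have hF : ∀ b, F b ∈ distTriang D := by rintro (_ | _) <;> assumption
  let p : ∀ b, T ⟶ F b := fun b => match b with | true => p₁ | false => p₂
  let π := productTriangle.π F
  let φ := productTriangle.lift F p
  have hφ : ∀ b, φ ≫ π b = p b := fun b => Fan.IsLimit.fac (productTriangle.isLimitFan F) p b
  let ψ : productTriangle F ⟶ T := π true ≫ i₁ + π false ≫ i₂
  refine isomorphic_distinguished _ (productTriangle_distinguished F hF) _
    { hom := φ, inv := ψ, hom_inv_id := ?_, inv_hom_id := ?_ }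
  · rw [Preadditive.comp_add, ← Category.assoc, ← Category.assoc, hφ, hφ]
    exact tot
  · refine Fan.IsLimit.hom_ext (productTriangle.isLimitFan F) _ _ ?_
    rintro (_ | _)
    · change (_ ≫ φ) ≫ π false = 𝟙 _ ≫ π false
      rw [Category.assoc, hφ, Preadditive.add_comp, Category.assoc, Category.assoc]
      change π true ≫ i₁ ≫ p₂ + π false ≫ i₂ ≫ p₂ = _
      rw [h₁₂, h₂₂, Category.id_comp, comp_zero, zero_add]
      exact Category.comp_id _
    · change (_ ≫ φ) ≫ π true = 𝟙 _ ≫ π true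
      rw [Category.assoc, hφ, Preadditive.add_comp, Category.assoc, Category.assoc]
      change π true ≫ i₁ ≫ p₁ + π false ≫ i₂ ≫ p₁ = _
      rw [h₁₁, h₂₁, Category.id_comp, comp_zero, add_zero]
      exact Category.comp_id _

lemma CategoryTheory.Pretriangulated.distinguished_of_biproduct' {A₁ A₂ B₁ B₂ C₁ C₂ : D}
    {f₁ : A₁ ⟶ B₁} {g₁ : B₁ ⟶ C₁} {h₁ : C₁ ⟶ A₁⟦(1 : ℤ)⟧} {f₂ : A₂ ⟶ B₂} {g₂ : B₂ ⟶ C₂}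
    {h₂ : C₂ ⟶ A₂⟦(1 : ℤ)⟧} (hT₁ : Triangle.mk f₁ g₁ h₁ ∈ distTriang D)
    (hT₂ : Triangle.mk f₂ g₂ h₂ ∈ distTriang D)
    (a : BinaryBicone A₁ A₂) (b : BinaryBicone B₁ B₂) (c : BinaryBicone C₁ C₂)
    (ha : a.fst ≫ a.inl + a.snd ≫ a.inr = 𝟙 _) (hb : b.fst ≫ b.inl + b.snd ≫ b.inr = 𝟙 _)
    (hc : c.fst ≫ c.inl + c.snd ≫ c.inr = 𝟙 _) {f : a.pt ⟶ b.pt} {g : b.pt ⟶ c.pt}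
    {h : c.pt ⟶ a.pt⟦(1 : ℤ)⟧} (hf : f = a.fst ≫ f₁ ≫ b.inl + a.snd ≫ f₂ ≫ b.inr)
    (hg : g = b.fst ≫ g₁ ≫ c.inl + b.snd ≫ g₂ ≫ c.inr)
    (hh : h = c.fst ≫ h₁ ≫ a.inl⟦(1 : ℤ)⟧' + c.snd ≫ h₂ ≫ a.inr⟦(1 : ℤ)⟧') :
    Triangle.mk f g h ∈ distTriang D := by
  have s₁ : a.inl⟦(1 : ℤ)⟧' ≫ a.fst⟦(1 : ℤ)⟧' = 𝟙 _ := by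
    rw [← Functor.map_comp, a.inl_fst, Functor.map_id]
  have s₂ : a.inl⟦(1 : ℤ)⟧' ≫ a.snd⟦(1 : ℤ)⟧' = 0 := by
    rw [← Functor.map_comp, a.inl_snd, Functor.map_zero]
  have s₃ : a.inr⟦(1 : ℤ)⟧' ≫ a.fst⟦(1 : ℤ)⟧' = 0 := by
    rw [← Functor.map_comp, a.inr_fst, Functor.map_zero]
  have s₄ : a.inr⟦(1 : ℤ)⟧' ≫ a.snd⟦(1 : ℤ)⟧' = 𝟙 _ := by
    rw [← Functor.map_comp, a.inr_snd, Functor.map_id]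
  let p₁ : Triangle.mk f g h ⟶ Triangle.mk f₁ g₁ h₁ :=
    { hom₁ := a.fst, hom₂ := b.fst, hom₃ := c.fst
      comm₁ := by change f ≫ b.fst = a.fst ≫ f₁; simp [hf]
      comm₂ := by change g ≫ c.fst = b.fst ≫ g₁; simp [hg]
      comm₃ := by change h ≫ a.fst⟦(1 : ℤ)⟧' = c.fst ≫ h₁; simp [hh, s₁, s₃] }
  let p₂ : Triangle.mk f g h ⟶ Triangle.mk f₂ g₂ h₂ :=
    { hom₁ := a.snd, hom₂ := b.snd, hom₃ := c.snd
      comm₁ := by change f ≫ b.snd = a.snd ≫ f₂; simp [hf]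
      comm₂ := by change g ≫ c.snd = b.snd ≫ g₂; simp [hg]
      comm₃ := by change h ≫ a.snd⟦(1 : ℤ)⟧' = c.snd ≫ h₂; simp [hh, s₂, s₄] }
  let i₁ : Triangle.mk f₁ g₁ h₁ ⟶ Triangle.mk f g h :=
    { hom₁ := a.inl, hom₂ := b.inl, hom₃ := c.inl
      comm₁ := by change f₁ ≫ b.inl = a.inl ≫ f; simp [hf]
      comm₂ := by change g₁ ≫ c.inl = b.inl ≫ g; simp [hg]
      comm₃ := by change h₁ ≫ a.inl⟦(1 : ℤ)⟧' = c.inl ≫ h; simp [hh] }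
  let i₂ : Triangle.mk f₂ g₂ h₂ ⟶ Triangle.mk f g h :=
    { hom₁ := a.inr, hom₂ := b.inr, hom₃ := c.inr
      comm₁ := by change f₂ ≫ b.inr = a.inr ≫ f; simp [hf]
      comm₂ := by change g₂ ≫ c.inr = b.inr ≫ g; simp [hg]
      comm₃ := by change h₂ ≫ a.inr⟦(1 : ℤ)⟧' = c.inr ≫ h; simp [hh] }
  exact distinguished_of_biproduct hT₁ hT₂ p₁ p₂ i₁ i₂
    (Triangle.hom_ext _ _ a.inl_fst b.inl_fst c.inl_fst)
    (Triangle.hom_ext _ _ a.inl_snd b.inl_snd c.inl_snd)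
    (Triangle.hom_ext _ _ a.inr_fst b.inr_fst c.inr_fst)
    (Triangle.hom_ext _ _ a.inr_snd b.inr_snd c.inr_snd)
    (Triangle.hom_ext _ _ ha hb hc)

variable (P : ObjectProperty D) [P.IsClosedUnderIsomorphisms] [P.IsTriangulatedClosed₂]

instance : HasBinaryBiproducts P.FullSubcategory where
  has_binary_biproduct X Y := by
    have h : P (X.obj ⊞ Y.obj) := P.ext_of_isTriangulatedClosed₂ _
      (binaryBiproductTriangle_distinguished X.obj Y.obj) X.property Y.property
    let Z : P.FullSubcategory := ⟨X.obj ⊞ Y.obj, h⟩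
    let b : BinaryBicone X Y :=
      { pt := Z
        fst := P.homMk biprod.fst
        snd := P.homMk biprod.snd
        inl := P.homMk biprod.inl
        inr := P.homMk biprod.inr
        inl_fst := by ext; exact biprod.inl_fst
        inl_snd := by ext; exact biprod.inl_snd
        inr_fst := by ext; exact biprod.inr_fst
        inr_snd := by ext; exact biprod.inr_snd }
    exact hasBinaryBiproduct_of_total b (by
      apply ObjectProperty.hom_ext
      change (biprod.fst ≫ biprod.inl + biprod.snd ≫ biprod.inr : X.obj ⊞ Y.obj ⟶ _) = 𝟙 _
      exact biprod.total)

variable {P} in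
/-- The image in `D` of a bicone in a full subcategory. -/
def CategoryTheory.ObjectProperty.mapBicone {X Y : P.FullSubcategory} (b : BinaryBicone X Y) :
    BinaryBicone X.obj Y.obj where
  pt := b.pt.obj
  fst := b.fst.hom
  snd := b.snd.hom
  inl := b.inl.hom
  inr := b.inr.hom
  inl_fst := congrArg (fun f => f.hom) b.inl_fst
  inl_snd := congrArg (fun f => f.hom) b.inl_snd
  inr_fst := congrArg (fun f => f.hom) b.inr_fst
  inr_snd := congrArg (fun f => f.hom) b.inr_snd

variable [P.ContainsZero] [IsTriangulated D]

/-- The extriangulated structure on an extension-closed full subcategory of a triangulated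
category: `𝔼(X, Y) = Hom(X, ΣY)`, and `δ : X ⟶ ΣY` is realized by `Y --x--> Z --y--> X` iff
`Y --x--> Z --y--> X --δ--> ΣY` is a distinguished triangle. -/
def CategoryTheory.ObjectProperty.extriangulated : Extriangulated.{v} P.FullSubcategory where
  E X Y := X.obj ⟶ Y.obj⟦(1 : ℤ)⟧
  pull f _ := Preadditive.leftComp _ f.hom
  push _ _ _ g := Preadditive.rightComp _ (g.hom⟦(1 : ℤ)⟧')
  pull_id δ := Category.id_comp δ
  pull_comp f' f δ := Category.assoc f'.hom f.hom δ
  push_id {X Y} δ := by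
    change δ ≫ (𝟙 Y.obj)⟦(1 : ℤ)⟧' = δ
    simp
  push_comp {X Y Y' Y''} g g' δ := by
    change δ ≫ (g.hom ≫ g'.hom)⟦(1 : ℤ)⟧' = (δ ≫ g.hom⟦(1 : ℤ)⟧') ≫ g'.hom⟦(1 : ℤ)⟧'
    simp
  pull_push f g δ := (Category.assoc f.hom δ (g.hom⟦(1 : ℤ)⟧')).symm
  pull_add f f' δ := Preadditive.add_comp _ _ _ f.hom f'.hom δ
  push_add g g' δ := by
    change δ ≫ (g.hom + g'.hom)⟦(1 : ℤ)⟧' = δ ≫ g.hom⟦(1 : ℤ)⟧' + δ ≫ g'.hom⟦(1 : ℤ)⟧'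
    rw [Functor.map_add, Preadditive.comp_add]
  Realizes δ x y := Triangle.mk x.hom y.hom δ ∈ distTriang D
  exists_realizes {X Y} δ := by
    obtain ⟨Z, hZ, a, b, h⟩ := P.distinguished_cocone_triangle₂ δ Y.property X.property
    exact ⟨⟨Z, hZ⟩, P.homMk a, P.homMk b, h⟩
  realizes_iff {X Y Z Z' δ x y} h x' y' := by
    constructor
    · intro h'
      obtain ⟨b, h₁, h₂⟩ := complete_distinguished_triangle_morphism₂ _ _ h h' (𝟙 Y.obj) (𝟙 X.obj)
        (by change δ ≫ (𝟙 Y.obj)⟦(1 : ℤ)⟧' = 𝟙 X.obj ≫ δ; simp)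
      change x.hom ≫ b = 𝟙 _ ≫ x'.hom at h₁
      change y.hom ≫ 𝟙 _ = b ≫ y'.hom at h₂
      let φ : Triangle.mk x.hom y.hom δ ⟶ Triangle.mk x'.hom y'.hom δ :=
        { hom₁ := 𝟙 Y.obj, hom₂ := b, hom₃ := 𝟙 X.obj, comm₁ := h₁, comm₂ := h₂,
          comm₃ := by change δ ≫ (𝟙 Y.obj)⟦(1 : ℤ)⟧' = 𝟙 X.obj ≫ δ; simp }
      have hb : IsIso φ.hom₂ := isIso₂_of_isIso₁₃ φ h h'
        (by change IsIso (𝟙 Y.obj); infer_instance) (by change IsIso (𝟙 X.obj); infer_instance)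
      refine ⟨P.isoMk (@asIso _ _ _ _ b hb), ?_, ?_⟩
      · ext
        exact h₁.trans (Category.id_comp _)
      · ext
        exact h₂.symm.trans (Category.comp_id _)
    · rintro ⟨e, h₁, h₂⟩
      refine isomorphic_distinguished _ h _ (Triangle.isoMk _ _ (Iso.refl _)
        (P.ι.mapIso e.symm) (Iso.refl _) ?_ ?_ ?_)
      · change x'.hom ≫ e.inv.hom = 𝟙 _ ≫ x.hom
        rw [← h₁, Category.id_comp]
        exact congrArg (fun f => f.hom) (show (x ≫ e.hom) ≫ e.inv = x by simp)
      · change y'.hom ≫ 𝟙 _ = e.inv.hom ≫ y.hom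
        rw [← h₂, Category.comp_id]
        exact congrArg (fun f => f.hom) (show y' = e.inv ≫ e.hom ≫ y' by simp)
      · change δ ≫ (𝟙 Y.obj)⟦(1 : ℤ)⟧' = 𝟙 X.obj ≫ δ
        simp
  exists_middle h h' g f hfg := by
    obtain ⟨b, h₁, h₂⟩ := complete_distinguished_triangle_morphism₂ _ _ h h' g.hom f.hom hfg
    exact ⟨P.homMk b, by ext; exact h₁, by ext; exact h₂⟩
  realizes_zero {X Y} b hb := by
    let a : BinaryBicone Y.obj (0 : D) :=
      { pt := Y.obj, fst := 𝟙 _, snd := 0, inl := 𝟙 _, inr := 0, inr_snd := by simp }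
    let c : BinaryBicone (0 : D) X.obj :=
      { pt := X.obj, fst := 0, snd := 𝟙 _, inl := 0, inr := 𝟙 _, inl_fst := by simp }
    have ha : a.fst ≫ a.inl + a.snd ≫ a.inr = 𝟙 _ := by simp [a]
    have hc : c.fst ≫ c.inl + c.snd ≫ c.inr = 𝟙 _ := by simp [c]
    refine distinguished_of_biproduct' (contractible_distinguished Y.obj)
      (contractible_distinguished₁ X.obj) a (ObjectProperty.mapBicone b) c ha
      (congrArg (fun f => f.hom) (IsBilimit.binary_total hb)) hc ?_ ?_ ?_
    · simp [a, ObjectProperty.mapBicone]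
      exact (add_zero _).symm
    · simp [c, ObjectProperty.mapBicone]
      exact (zero_add _).symm
    · simp [a, c]
  realizes_sum {X Y Z X' Y' Z' δ x y δ' x' y'} h h' bX bY bZ hX hY hZ := by
    refine distinguished_of_biproduct' h h' (ObjectProperty.mapBicone bY) (ObjectProperty.mapBicone bZ) (ObjectProperty.mapBicone bX)
      (congrArg (fun f => f.hom) (IsBilimit.binary_total hY))
      (congrArg (fun f => f.hom) (IsBilimit.binary_total hZ))
      (congrArg (fun f => f.hom) (IsBilimit.binary_total hX)) rfl rfl rfl
  et3 h h' g b hgb := by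
    obtain ⟨f, h₁, h₂⟩ := complete_distinguished_triangle_morphism _ _ h h' g.hom b.hom
      (congrArg (fun f => f.hom) hgb)
    exact ⟨P.homMk f, by ext; exact h₁, h₂⟩
  et3_op h h' b f hbf := by
    obtain ⟨g, h₁, h₂⟩ := complete_distinguished_triangle_morphism₁ _ _ h h' b.hom f.hom
      (congrArg (fun f => f.hom) hbf)
    exact ⟨P.homMk g, by ext; exact h₁, h₂⟩
  et4 {A B C' D' F δ f f' δ' g g'} h h' := by
    obtain ⟨G, k, δ'', h''⟩ := distinguished_cocone_triangle (f.hom ≫ g.hom)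
    let o := someOctahedron rfl h h' h''
    have hG : P G := P.ext_of_isTriangulatedClosed₂ _ o.mem D'.property F.property
    exact ⟨⟨G, hG⟩, P.homMk o.m₁, P.homMk o.m₃, P.homMk k, δ'', h'', by ext; exact o.comm₁,
      by ext; exact o.comm₃, o.mem, o.comm₂, o.comm₄⟩
  et4_op {A B C' D' F δ f' f δ' g' g} h h' := by
    obtain ⟨G, k, δ'', h''⟩ := distinguished_cocone_triangle₁ (f.hom ≫ g.hom)
    let o := someOctahedron' rfl h h' h''
    have hG : P G := P.ext_of_isTriangulatedClosed₂ _ o.mem D'.property F.property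
    exact ⟨⟨G, hG⟩, P.homMk o.m₁, P.homMk o.m₃, P.homMk k, δ'', h'', by ext; exact o.comm₁,
      by ext; exact o.comm₄.symm, o.mem, o.comm₃, o.comm₂⟩

end ExtensionClosed

section TStructure

variable {D : Type u} [Category.{v} D] [Preadditive D] [HasZeroObject D] [HasShift D ℤ]
  [∀ n : ℤ, (shiftFunctor D n).Additive] [Pretriangulated D]

namespace CategoryTheory.ObjectProperty

/-- The property of being a product of a set-indexed family of objects satisfying `P`. -/
def coFree (P : ObjectProperty D) : ObjectProperty D := fun X =>
  ∃ (J : Type t) (F : J → D) (p : ∀ j, X ⟶ F j),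
    Nonempty (IsLimit (Fan.mk X p)) ∧ ∀ j, P (F j)

instance (P : ObjectProperty D) [P.IsClosedUnderIsomorphisms] [P.IsTriangulatedClosed₂] (n : ℤ) :
    (P.shift n).IsTriangulatedClosed₂ :=
  .mk' fun T hT h₁ h₃ =>
    P.ext_of_isTriangulatedClosed₂ _ (Triangle.shift_distinguished T hT n) h₁ h₃

instance (P : ObjectProperty D) [P.IsClosedUnderIsomorphisms] [P.ContainsZero] (n : ℤ) :
    (P.shift n).ContainsZero where
  exists_zero := ⟨_, isZero_zero D, P.prop_of_isZero ((shiftFunctor D n).map_isZero (isZero_zero D))⟩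

end CategoryTheory.ObjectProperty

namespace CategoryTheory.Triangulated.TStructure

variable (x : TStructure D)

/-- The t-structure `(U, W)` is co-smashing if its aisle `U` is closed under all products which
exist in the ambient category. -/
def IsCoSmashing : Prop := (x.le 0).coFree.{t} = x.le 0

instance : (x.le 0).ContainsZero where
  exists_zero := ⟨_, isZero_zero D, (x.isLE_of_isZero (isZero_zero D) 0).le⟩

instance (n : ℤ) : (x.le n).IsTriangulatedClosed₂ :=
  .mk' fun T hT h₁ h₃ => (x.isLE₂ T hT n ⟨h₁⟩ ⟨h₃⟩).le

instance (n : ℤ) : (x.ge n).IsTriangulatedClosed₂ :=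
  .mk' fun T hT h₁ h₃ => (x.isGE₂ T hT n ⟨h₁⟩ ⟨h₃⟩).ge

instance : x.heart.IsTriangulatedClosed₂ :=
  .mk' fun T hT h₁ h₃ =>
    ⟨(x.le 0).ext_of_isTriangulatedClosed₂ T hT h₁.1 h₃.1,
      (x.ge 0).ext_of_isTriangulatedClosed₂ T hT h₁.2 h₃.2⟩

instance : x.heart.ContainsZero where
  exists_zero := ⟨_, isZero_zero D, (x.isLE_of_isZero (isZero_zero D) 0).le,
    (x.isGE_of_isZero (isZero_zero D) 0).ge⟩

/-- The extended heart `H ⋆ Σ⁻¹H`. Here `Σ⁻¹H`, which consists of the objects `X` such that `ΣX`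
belongs to `H`, is `H.shift 1`. -/
def extendedHeart : ObjectProperty D := x.heart.extensionProduct (x.heart.shift (1 : ℤ))

instance : x.extendedHeart.IsClosedUnderIsomorphisms :=
  inferInstanceAs (ObjectProperty.extensionProduct _ _).IsClosedUnderIsomorphisms

lemma extendedHeart_eq : x.extendedHeart = x.ge 0 ⊓ (x.le 0).shift (1 : ℤ) := by
  rw [x.shift_le 1 0 1 rfl]
  ext X
  constructor
  · rintro ⟨Y, Z, f, g, h, hT, hY, hZ⟩
    have hZ₁ : x.le 1 Z := by rw [← x.shift_le 1 0 1 rfl]; exact hZ.1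
    have hZ₂ : x.ge 1 Z := by rw [← x.shift_ge 1 0 1 rfl]; exact hZ.2
    exact ⟨(x.ge 0).ext_of_isTriangulatedClosed₂ _ hT hY.2 (x.ge_antitone (by lia) _ hZ₂),
      (x.le 1).ext_of_isTriangulatedClosed₂ _ hT (x.le_monotone (by lia) _ hY.1) hZ₁⟩
  · rintro ⟨h₀, h₁⟩
    obtain ⟨Y, Z, hY, hZ, f, g, h, hT⟩ := x.exists_triangle X 0 1 rfl
    refine ⟨Y, Z, f, g, h, hT, ⟨hY, ?_⟩, ?_⟩
    · exact (x.ge 0).ext_of_isTriangulatedClosed₂ _ (inv_rot_of_distTriang _ hT)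
        (x.ge_antitone (by lia) _ (x.ge_shift 1 (-1) 2 (by lia) Z hZ)) h₀
    · have hZ' : x.le 1 Z := (x.le 1).ext_of_isTriangulatedClosed₂ _ (rot_of_distTriang _ hT)
        h₁ (x.le_monotone (by lia) _ (x.le_shift 0 1 (-1) (by lia) Y hY))
      rw [← x.shift_le 1 0 1 rfl] at hZ'
      rw [← x.shift_ge 1 0 1 rfl] at hZ
      exact ⟨hZ', hZ⟩

instance : x.extendedHeart.IsTriangulatedClosed₂ :=
  .mk' fun T hT h₁ h₃ => by
    rw [extendedHeart_eq] at h₁ h₃ ⊢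
    exact ⟨(x.ge 0).ext_of_isTriangulatedClosed₂ T hT h₁.1 h₃.1,
      ((x.le 0).shift (1 : ℤ)).ext_of_isTriangulatedClosed₂ T hT h₁.2 h₃.2⟩

instance : x.extendedHeart.ContainsZero where
  exists_zero := ⟨_, isZero_zero D, by
    rw [extendedHeart_eq]
    exact ⟨(x.isGE_of_isZero (isZero_zero D) 0).ge,
      ((x.le 0).shift (1 : ℤ)).prop_of_isZero (isZero_zero D)⟩⟩

end CategoryTheory.Triangulated.TStructure

end TStructure

section HRS

variable {A : Type u} [Category.{v} A] [Abelian A]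

/-- `(T, F)` is a torsion pair in the abelian category `A`. -/
structure IsTorsionPair (T F : ObjectProperty A) : Prop where
  torsion_iso : T.IsClosedUnderIsomorphisms
  free_iso : F.IsClosedUnderIsomorphisms
  hom_eq_zero {X Y : A} (hX : T X) (hY : F Y) (f : X ⟶ Y) : f = 0
  exists_shortExact (X : A) : ∃ S : ShortComplex A, S.ShortExact ∧ S.X₂ = X ∧ T S.X₁ ∧ F S.X₃

/-- `x` is the t-structure on `D(A)` obtained by Happel–Reiten–Smalø tilting from the pair
`(T, F)`: its aisle consists of the `X` with `Hⁿ(X) = 0` for `n > 0` and `H⁰(X)` in `T`, and its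
coaisle of the `X` with `Hⁿ(X) = 0` for `n < -1` and `H⁻¹(X)` in `F`. -/
structure IsHRSTilt [HasDerivedCategory.{w} A] (T F : ObjectProperty A)
    (x : TStructure (DerivedCategory A)) : Prop where
  aisle (X : DerivedCategory A) : x.le 0 X ↔
    (∀ n : ℤ, 0 < n → IsZero ((DerivedCategory.homologyFunctor A n).obj X)) ∧
      T ((DerivedCategory.homologyFunctor A 0).obj X)
  coaisle (X : DerivedCategory A) : x.ge 0 X ↔
    (∀ n : ℤ, n < -1 → IsZero ((DerivedCategory.homologyFunctor A n).obj X)) ∧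
      F ((DerivedCategory.homologyFunctor A (-1)).obj X)

end HRS

/-- `Gen M` is the class of all quotients of coproducts of copies of `M`. -/
def Gen {R : Type t} [Ring R] (M : Type t) [AddCommGroup M] [Module R M] :
    ObjectProperty (ModuleCat.{t} R) := fun N =>
  ∃ (J : Type t) (f : (J →₀ M) →ₗ[R] N), Function.Surjective f

/-- The ring `R = ∏_ℕ ℤ/2`. -/
abbrev ProdRing : Type := ℕ → ZMod 2

/-- The component ideal `R_j = ℤ/2` of `R`. -/
def componentIdeal (j : ℕ) : Ideal ProdRing where
  carrier := {a | ∀ i, i ≠ j → a i = 0}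
  zero_mem' := fun _ _ => rfl
  add_mem' := fun ha hb i hi => by simp [ha i hi, hb i hi]
  smul_mem' := fun c a ha i hi => by simp [ha i hi]

/-- The ideal `⊕_j R_j` of `R`. -/
def sumIdeal : Ideal ProdRing := ⨆ j, componentIdeal j

/-! ### Modules over the Boolean ring `ProdRing` and the torsion pair. -/

section Modules

/-! Write T = Gen(I) and F = Gen(R/I). Since R is Boolean, T consists of the modules in which each
element is fixed by some element of I, and F of those killed by I. Hence both classes are closed
under submodules, Hom vanishes between them in both directions, and I is projective. Truncating and
then splitting the top homology along the torsion pair gives the tilt `genTilt`.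

Positive part. Products in Mod(R) are exact, so D has products, and truncating them gives products
in the heart (`exists_isProductIn`). The heart has two test objects: I in degree 0 and R/I in degree
-1. Both have no extensions by heart objects (`hom_single_idealModule_eq_zero`,
`hom_single_quotientModule_eq_zero`), so maps from them lift along the product of a family of
deflations. As they detect epimorphisms on homology, that product map is epi on all homology; the
homology of its fibre embeds in that of the source, and closure under submodules puts the fibre in
the heart. So products of conflations are conflations, and `isAET4Star_of_products` turns this into
AET4*: a class in E(Y, ∏ Bᵢ) is determined by its components, so the required transformation is
unique and automatically natural and additive. The same argument in any degree `n` covers both the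
heart and its desuspension (`isAET4Star_of_iff_genTilt`).

Negative part. Any map from R to a module in T is killed by all but finitely many of the idempotents
e_j, whereas the projection R → R_j is not killed by e_j (`exists_mulIdem_comp_eq_zero`). So the
projections cannot be assembled into one map R → X with H⁰(X) in T that recovers all of them. With
R_j in degree 0, the product would give such a map if the aisle were closed under products. In the
extended heart, which contains R in degree 0 and R_j in degree 1, the projections are extension
classes, and AET4* would assemble them into one. -/

lemma ProdRing.mul_self (a : ProdRing) : a * a = a := by
  ext i
  have : ∀ x : ZMod 2, x * x = x := by decide
  exact this _

/-- The idempotent of `R` which generates the `j`-th component ideal. -/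
def ProdRing.idem (j : ℕ) : ProdRing := Pi.single j 1

open ProdRing in
lemma idem_mem_sumIdeal (j : ℕ) : idem j ∈ sumIdeal :=
  Submodule.mem_iSup_of_mem j fun i hi => by simp [idem, hi]

lemma eventually_zero_of_mem_sumIdeal {a : ProdRing} (ha : a ∈ sumIdeal) :
    ∃ N, ∀ i, N ≤ i → a i = 0 := by
  induction ha using Submodule.iSup_induction' with
  | mem j x hx => exact ⟨j + 1, fun i hi => hx i (by lia)⟩
  | zero => exact ⟨0, fun _ _ => rfl⟩
  | add x y _ _ hx hy =>
    obtain ⟨N, hN⟩ := hx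
    obtain ⟨N', hN'⟩ := hy
    exact ⟨max N N', fun i hi => by simp [hN i (by lia), hN' i (by lia)]⟩

lemma ProdRing.mul_idem (a : ProdRing) (j : ℕ) : a * idem j = Pi.single j (a j) := by
  ext i
  by_cases h : i = j
  · subst h; simp [idem]
  · simp [idem, h]

/-- The elements of a module which are fixed by an element of `⊕ R_j`. -/
def sumTorsion (M : Type*) [AddCommGroup M] [Module ProdRing M] : Submodule ProdRing M where
  carrier := {m | ∃ e ∈ sumIdeal, e • m = m}
  zero_mem' := ⟨0, zero_mem _, smul_zero _⟩
  add_mem' := by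
    rintro m m' ⟨e, he, hm⟩ ⟨e', he', hm'⟩
    -- The join of two idempotents fixes whatever either of them fixes.
    refine ⟨e + e' - e * e', sub_mem (add_mem he he') (Ideal.mul_mem_right _ _ he), ?_⟩
    have h₁ : (e + e' - e * e') • m = m := by
      rw [mul_comm, sub_smul, add_smul, mul_smul, hm, add_sub_cancel_right]
    have h₂ : (e + e' - e * e') • m' = m' := by
      rw [sub_smul, add_smul, mul_smul, hm', add_sub_cancel_left]
    rw [smul_add, h₁, h₂]
  smul_mem' := by
    rintro r m ⟨e, he, hm⟩
    exact ⟨e, he, by rw [smul_comm, hm]⟩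

/-- Each `a` in I satisfies `a * a = a`, so it is fixed by itself; this passes to finite sums and
quotients. Conversely, if `e` fixes `m`, the map I → M, a ↦ am, reaches `m` at `e`. -/
lemma gen_sumIdeal_iff (M : ModuleCat.{0} ProdRing) :
    Gen (R := ProdRing) sumIdeal M ↔ ∀ m : M, ∃ e ∈ sumIdeal, e • m = m := by
  constructor
  · rintro ⟨J, f, hf⟩ m
    obtain ⟨g, rfl⟩ := hf m
    change f g ∈ sumTorsion M
    induction g using Finsupp.induction_linear with
    | zero => rw [map_zero]; exact zero_mem _
    | add f g hf hg => rw [map_add]; exact add_mem hf hg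
    | single j a =>
      refine ⟨a.1, a.2, ?_⟩
      have h : a.1 • a = a := Subtype.ext (ProdRing.mul_self _)
      rw [← map_smul, Finsupp.smul_single, h]
  · intro h
    refine ⟨M, Finsupp.lsum ℕ fun m =>
      (LinearMap.toSpanSingleton ProdRing M m).comp sumIdeal.subtype, fun m => ?_⟩
    obtain ⟨e, he, hm⟩ := h m
    exact ⟨Finsupp.single m ⟨e, he⟩, by
      rw [Finsupp.lsum_single]
      exact hm⟩

lemma gen_quotient_iff (M : ModuleCat.{0} ProdRing) :
    Gen (R := ProdRing) (ProdRing ⧸ sumIdeal) M ↔ ∀ a ∈ sumIdeal, ∀ m : M, a • m = 0 := by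
  constructor
  · rintro ⟨J, f, hf⟩ a ha m
    obtain ⟨g, rfl⟩ := hf m
    rw [← map_smul]
    have : a • g = 0 := by
      ext j
      obtain ⟨x, hx⟩ := Submodule.Quotient.mk_surjective _ (g j)
      rw [Finsupp.smul_apply, ← hx, ← Submodule.Quotient.mk_smul]
      exact (Submodule.Quotient.mk_eq_zero _).2 (Ideal.mul_mem_right _ _ ha)
    rw [this, map_zero]
  · intro h
    refine ⟨M, Finsupp.lsum ℕ fun m => Submodule.liftQ sumIdeal
      (LinearMap.toSpanSingleton ProdRing M m) (fun a ha => ?_), fun m => ?_⟩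
    · exact h a ha m
    · refine ⟨Finsupp.single m (Submodule.Quotient.mk 1), ?_⟩
      rw [Finsupp.lsum_single]
      exact one_smul ProdRing m

lemma gen_sumIdeal_of_mono {M N : ModuleCat.{0} ProdRing} (f : M ⟶ N) [Mono f]
    (hN : Gen (R := ProdRing) sumIdeal N) : Gen (R := ProdRing) sumIdeal M := by
  rw [gen_sumIdeal_iff] at hN ⊢
  intro m
  obtain ⟨e, he, h⟩ := hN (f m)
  exact ⟨e, he, (ModuleCat.mono_iff_injective f).1 inferInstance (by rw [map_smul, h])⟩

lemma gen_quotient_of_mono {M N : ModuleCat.{0} ProdRing} (f : M ⟶ N) [Mono f]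
    (hN : Gen (R := ProdRing) (ProdRing ⧸ sumIdeal) N) :
    Gen (R := ProdRing) (ProdRing ⧸ sumIdeal) M := by
  rw [gen_quotient_iff] at hN ⊢
  intro a ha m
  exact (ModuleCat.mono_iff_injective f).1 inferInstance (by rw [map_smul, hN a ha, map_zero])

lemma eq_zero_of_gen_sumIdeal_of_gen_quotient {M N : ModuleCat.{0} ProdRing}
    (hM : Gen (R := ProdRing) sumIdeal M) (hN : Gen (R := ProdRing) (ProdRing ⧸ sumIdeal) N)
    (f : M ⟶ N) : f = 0 := by
  rw [gen_sumIdeal_iff] at hM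
  rw [gen_quotient_iff] at hN
  ext m
  obtain ⟨e, he, h⟩ := hM m
  rw [← h, map_smul, hN e he, map_smul]
  simp

/-- Orthogonality in the direction not required of a torsion pair: if `e` in I fixes `f m`, then `f
m = f (e • m) = 0`. It is what makes R/I rigid against heart objects later on. -/
lemma eq_zero_of_gen_quotient_of_gen_sumIdeal {M N : ModuleCat.{0} ProdRing}
    (hM : Gen (R := ProdRing) (ProdRing ⧸ sumIdeal) M) (hN : Gen (R := ProdRing) sumIdeal N)
    (f : M ⟶ N) : f = 0 := by
  rw [gen_sumIdeal_iff] at hN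
  rw [gen_quotient_iff] at hM
  ext m
  obtain ⟨e, he, h⟩ := hN (f m)
  rw [← h, ← map_smul, hM e he, map_zero]
  simp

lemma gen_sumIdeal_self : Gen (R := ProdRing) sumIdeal (ModuleCat.of ProdRing sumIdeal) :=
  (gen_sumIdeal_iff _).2 fun a => ⟨a.1, a.2, Subtype.ext (ProdRing.mul_self _)⟩

lemma gen_quotient_self : Gen (R := ProdRing) (ProdRing ⧸ sumIdeal)
    (ModuleCat.of ProdRing (ProdRing ⧸ sumIdeal)) :=
  ⟨Unit, Finsupp.lapply (), fun m => ⟨Finsupp.single () m, by simp⟩⟩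

lemma gen_isClosedUnderIsomorphisms {R : Type t} [Ring R] (M : Type t) [AddCommGroup M]
    [Module R M] : (Gen (R := R) M).IsClosedUnderIsomorphisms where
  of_iso := by
    rintro X Y e ⟨J, f, hf⟩
    exact ⟨J, e.toLinearEquiv.toLinearMap.comp f, e.toLinearEquiv.surjective.comp hf⟩

lemma isTorsionPair_gen :
    IsTorsionPair (Gen (R := ProdRing) sumIdeal) (Gen (R := ProdRing) (ProdRing ⧸ sumIdeal)) where
  torsion_iso := gen_isClosedUnderIsomorphisms _
  free_iso := gen_isClosedUnderIsomorphisms _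
  hom_eq_zero hX hY f := eq_zero_of_gen_sumIdeal_of_gen_quotient hX hY f
  exists_shortExact X := by
    let S : ShortComplex (ModuleCat.{0} ProdRing) :=
      ShortComplex.mk (ModuleCat.ofHom (sumTorsion X).subtype) (ModuleCat.ofHom (sumTorsion X).mkQ)
        (by ext; simp)
    refine ⟨S, ?_, rfl, ?_, ?_⟩
    · have : Mono S.f := (ModuleCat.mono_iff_injective _).2 (sumTorsion X).subtype_injective
      have : Epi S.g := (ModuleCat.epi_iff_surjective _).2 (sumTorsion X).mkQ_surjective
      refine ⟨(ShortComplex.ShortExact.moduleCat_exact_iff_function_exact S).2 ?_⟩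
      intro x
      exact ⟨fun h => ⟨⟨x, (Submodule.Quotient.mk_eq_zero _).1 h⟩, rfl⟩,
        fun ⟨y, hy⟩ => hy ▸ (Submodule.Quotient.mk_eq_zero _).2 y.2⟩
    · rw [gen_sumIdeal_iff]
      rintro ⟨m, e, he, h⟩
      exact ⟨e, he, Subtype.ext h⟩
    · rw [gen_quotient_iff]
      intro a ha m
      obtain ⟨x, rfl⟩ := (sumTorsion X).mkQ_surjective m
      change a • (sumTorsion X).mkQ x = 0
      rw [← map_smul]
      -- For `a` in I the element `a • x` is fixed by `a` itself, hence torsion.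
      refine (Submodule.Quotient.mk_eq_zero _).2 ⟨a, ha, ?_⟩
      rw [← mul_smul, ProdRing.mul_self]

/-- The map from the free module on ℕ sending the j-th basis vector to e_j is split by a ↦ (a
e_j)_j, which has finite support because elements of I do. -/
instance projective_sumIdeal : Module.Projective ProdRing sumIdeal := by
  have hfin : ∀ a ∈ sumIdeal, (Function.support fun j => a * ProdRing.idem j).Finite := by
    intro a ha
    obtain ⟨N, hN⟩ := eventually_zero_of_mem_sumIdeal ha
    refine (Set.finite_lt_nat N).subset fun j hj => ?_
    by_contra h
    exact hj (by simp [ProdRing.mul_idem, hN j (not_lt.1 h)])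
  let i : sumIdeal →ₗ[ProdRing] ℕ →₀ ProdRing :=
    { toFun := fun a => Finsupp.ofSupportFinite (fun j => a.1 * ProdRing.idem j) (hfin a.1 a.2)
      map_add' := fun a b => by ext1 j; exact add_mul a.1 b.1 _
      map_smul' := fun r a => by ext1 j; exact mul_assoc r a.1 _ }
  let s : (ℕ →₀ ProdRing) →ₗ[ProdRing] sumIdeal := Finsupp.lsum ℕ fun j =>
    LinearMap.toSpanSingleton ProdRing sumIdeal ⟨ProdRing.idem j, idem_mem_sumIdeal j⟩
  refine Module.Projective.of_split i s ?_
  ext a n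
  have h : ((s (i a)).1 : ProdRing) = (i a).sum fun j x => x * ProdRing.idem j := by
    change sumIdeal.subtype ((i a).sum _) = _
    rw [map_finsuppSum]
    rfl
  change (s (i a)).1 n = a.1 n
  rw [h, Finsupp.sum, Finset.sum_apply]
  have h' : ∀ j, (i a) j * ProdRing.idem j = Pi.single j (a.1 j) := by
    intro j
    change a.1 * ProdRing.idem j * ProdRing.idem j = _
    rw [mul_assoc, ProdRing.mul_self, ProdRing.mul_idem]
  simp only [h']
  rw [Finset.sum_pi_single]
  split_ifs with hn
  · rfl
  · have : a.1 * ProdRing.idem n = 0 := Finsupp.notMem_support_iff.1 hn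
    rw [ProdRing.mul_idem, Pi.single_eq_zero_iff] at this
    exact this.symm

end Modules

/-! ### Happel–Reiten–Smalø tilting. -/

section HRSTilt

open DerivedCategory

variable {A : Type u} [Category.{v} A] [Abelian A] [HasDerivedCategory.{w} A]

lemma DerivedCategory.isZero_homology_single (X : A) (n i : ℤ) (h : i ≠ n) :
    IsZero ((homologyFunctor A i).obj ((singleFunctor A n).obj X)) := by
  rcases lt_or_gt_of_ne h with h | h
  · exact isZero_of_isGE _ n i h
  · exact isZero_of_isLE _ n i h

lemma DerivedCategory.isIso_homology_truncGEπ (X : DerivedCategory A) (n : ℤ) :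
    IsIso ((homologyFunctor A n).map ((TStructure.t.truncGEπ n).app X)) := by
  have hT := TStructure.t.triangleLTGE_distinguished n X
  have h₁ : IsZero ((homologyFunctor A n).obj ((TStructure.t.triangleLTGE n).obj X).obj₁) :=
    isZero_of_isLE ((TStructure.t.truncLT n).obj X) (n - 1) n (by lia)
  have h₂ : IsZero ((homologyFunctor A (n + 1)).obj ((TStructure.t.triangleLTGE n).obj X).obj₁) :=
    isZero_of_isLE ((TStructure.t.truncLT n).obj X) (n - 1) (n + 1) (by lia)
  have : Mono ((homologyFunctor A n).map ((TStructure.t.truncGEπ n).app X)) :=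
    (HomologySequence.mono_homologyMap_mor₂_iff _ hT n).2 (h₁.eq_of_src _ _)
  have : Epi ((homologyFunctor A n).map ((TStructure.t.truncGEπ n).app X)) :=
    (HomologySequence.epi_homologyMap_mor₂_iff _ hT n (n + 1) rfl).2 (h₂.eq_of_tgt _ _)
  exact isIso_of_mono_of_epi _

lemma DerivedCategory.isLE_truncGE (X : DerivedCategory A) (n : ℤ) [X.IsLE n] :
    ((TStructure.t.truncGE n).obj X).IsLE n := by
  have hT := TStructure.t.triangleLTGE_distinguished n X
  have h₁ : ((TStructure.t.truncLT n).obj X).IsLE (n - 1) := inferInstance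
  have := TStructure.t.isLE_shift ((TStructure.t.truncLT n).obj X) (n - 1) 1 (n - 2)
  exact TStructure.t.isLE₂ _ (rot_of_distTriang _ hT) n ‹_›
    (TStructure.t.isLE_of_le (((TStructure.t.truncLT n).obj X)⟦(1 : ℤ)⟧) (n - 2) n)

/-- A morphism from the top homology object of `X` comes from a morphism in the derived
category. -/
lemma DerivedCategory.exists_toSingle (X : DerivedCategory A) (n : ℤ) [X.IsLE n] {N : A}
    (ψ : (homologyFunctor A n).obj X ⟶ N) :
    ∃ p : X ⟶ (singleFunctor A n).obj N,
      (homologyFunctor A n).map p ≫ (singleFunctorCompHomologyFunctorIso A n).hom.app N = ψ := by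
  -- As `X` lives in degrees ≤ n, its truncation above `n` is a single module in degree `n`, with
  -- the same n-th homology as `X`.
  have := isLE_truncGE X n
  obtain ⟨M, ⟨e⟩⟩ :=
    exists_iso_singleFunctor_obj_of_isGE_of_isLE ((TStructure.t.truncGE n).obj X) n
  have := isIso_homology_truncGEπ X n
  let q := (TStructure.t.truncGEπ n).app X ≫ e.hom
  have : IsIso ((homologyFunctor A n).map q) := by
    rw [Functor.map_comp]; infer_instance
  let φ : M ⟶ N := (singleFunctorCompHomologyFunctorIso A n).inv.app M ≫
    inv ((homologyFunctor A n).map q) ≫ ψ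
  refine ⟨q ≫ (singleFunctor A n).map φ, ?_⟩
  have nat := (singleFunctorCompHomologyFunctorIso A n).hom.naturality φ
  dsimp at nat
  rw [Functor.map_comp, Category.assoc, nat]
  simp [φ]

/-- The map factors through the n-th truncations of `X` and `Y`, which are concentrated in degree
`n`, and there the single functor is full, so the map comes from a map of objects that Hⁿ detects.
-/
lemma DerivedCategory.hom_eq_zero_of_homologyMap_eq_zero {X Y : DerivedCategory A} (n : ℤ)
    [X.IsLE n] [hY : Y.IsGE n] (f : X ⟶ Y) (hf : (homologyFunctor A n).map f = 0) : f = 0 := by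
  have := isLE_truncGE X n
  have := isIso_homology_truncGEπ X n
  let g := TStructure.t.descTruncGE f n
  have hg : (TStructure.t.truncGEπ n).app X ≫ g = f := by simp [g]
  let g' := TStructure.t.liftTruncLT g n (n + 1) rfl
  have hg' : g' ≫ (TStructure.t.truncLTι (n + 1)).app Y = g := by simp [g']
  have hT := TStructure.t.triangleLTGE_distinguished (n + 1) Y
  have : ((TStructure.t.truncLT (n + 1)).obj Y).IsGE n := by
    have := TStructure.t.isGE_shift ((TStructure.t.truncGE (n + 1)).obj Y) (n + 1) (-1) (n + 2)
    exact TStructure.t.isGE₂ _ (inv_rot_of_distTriang _ hT) n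
      (TStructure.t.isGE_of_ge (((TStructure.t.truncGE (n + 1)).obj Y)⟦(-1 : ℤ)⟧) n (n + 2)) hY
  have : ((TStructure.t.truncLT (n + 1)).obj Y).IsLE n := inferInstance
  have : Mono ((homologyFunctor A n).map ((TStructure.t.truncLTι (n + 1)).app Y)) :=
    (HomologySequence.mono_homologyMap_mor₁_iff _ hT (n - 1) n (by lia)).2
      ((isZero_of_isGE ((TStructure.t.truncGE (n + 1)).obj Y) (n + 1) (n - 1)
        (by lia)).eq_of_src _ _)
  have h₀ : (homologyFunctor A n).map g' = 0 := by
    rw [← cancel_mono ((homologyFunctor A n).map ((TStructure.t.truncLTι (n + 1)).app Y)),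
      ← cancel_epi ((homologyFunctor A n).map ((TStructure.t.truncGEπ n).app X)),
      ← Functor.map_comp, hg', ← Functor.map_comp, hg, hf]
    simp
  obtain ⟨M, ⟨e⟩⟩ :=
    exists_iso_singleFunctor_obj_of_isGE_of_isLE ((TStructure.t.truncGE n).obj X) n
  obtain ⟨N, ⟨e'⟩⟩ :=
    exists_iso_singleFunctor_obj_of_isGE_of_isLE ((TStructure.t.truncLT (n + 1)).obj Y) n
  obtain ⟨φ, hφ⟩ := (singleFunctor A n).map_surjective (e.inv ≫ g' ≫ e'.hom)
  have nat := (singleFunctorCompHomologyFunctorIso A n).hom.naturality φ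
  dsimp at nat
  rw [hφ, Functor.map_comp, Functor.map_comp, h₀] at nat
  have hφ₀ : φ = 0 := by
    rw [← cancel_epi ((singleFunctorCompHomologyFunctorIso A n).hom.app M)]
    simpa using nat.symm
  have h₁ : g' = 0 := by
    rw [← cancel_mono e'.hom, ← cancel_epi e.inv, ← hφ, hφ₀]
    simp
  rw [← hg, ← hg', h₁]
  simp

namespace IsTorsionPair

variable {A : Type u} [Category.{v} A] [Abelian A] {T F : ObjectProperty A}
  (h : IsTorsionPair T F)

include h in
lemma torsion_of_isZero {X : A} (hX : IsZero X) : T X := by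
  obtain ⟨S, hS, rfl, h₁, -⟩ := h.exists_shortExact X
  have := h.torsion_iso
  have := hS.mono_f
  exact T.prop_of_iso (((IsZero.of_mono S.f hX).iso hX)) h₁

include h in
lemma free_of_isZero {X : A} (hX : IsZero X) : F X := by
  obtain ⟨S, hS, rfl, -, h₁⟩ := h.exists_shortExact X
  have := h.free_iso
  have := hS.epi_g
  exact F.prop_of_iso (((IsZero.of_epi S.g hX).iso hX)) h₁

include h in
lemma exists_shortExact' (X : A) : ∃ (S₁ S₃ : A) (a : S₁ ⟶ X) (b : X ⟶ S₃) (zero : a ≫ b = 0),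
    (ShortComplex.mk a b zero).ShortExact ∧ T S₁ ∧ F S₃ := by
  obtain ⟨S, hS, rfl, h₁, h₃⟩ := h.exists_shortExact X
  exact ⟨_, _, S.f, S.g, S.zero, hS, h₁, h₃⟩

variable [HasDerivedCategory.{w} A]

-- Push the torsion-free quotient `S₃` of H⁰ out of the truncation `B`: the fibre of B → S₃ is the
-- aisle part, and the octahedron exhibits the other part as an extension of `Y` by `S₃`.
include h in
lemma exists_triangle (X : DerivedCategory A) :
    ∃ (U V : DerivedCategory A)
      (_ : (∀ i : ℤ, 0 < i → IsZero ((homologyFunctor A i).obj U)) ∧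
        T ((homologyFunctor A 0).obj U))
      (_ : (∀ i : ℤ, i < 0 → IsZero ((homologyFunctor A i).obj V)) ∧
        F ((homologyFunctor A 0).obj V))
      (f : U ⟶ X) (g : X ⟶ V) (h : V ⟶ U⟦(1 : ℤ)⟧), Triangle.mk f g h ∈ distTriang _ := by
  obtain ⟨B, Y, hB, hY, f, g, k, hT⟩ := TStructure.t.exists_triangle X 0 1 rfl
  have hB : B.IsLE 0 := ⟨hB⟩
  have hY : Y.IsGE 1 := ⟨hY⟩
  obtain ⟨S₁, S₃, a, b, zero, hS, h₁, h₃⟩ := h.exists_shortExact' ((homologyFunctor A 0).obj B)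
  have : Mono a := hS.mono_f
  have : Epi b := hS.epi_g
  obtain ⟨p, hp⟩ := exists_toSingle B 0 b
  have hpe : Epi ((homologyFunctor A 0).map p) := by
    have : Epi ((homologyFunctor A 0).map p ≫
      (singleFunctorCompHomologyFunctorIso A 0).hom.app S₃) := by rw [hp]; infer_instance
    have e : (homologyFunctor A 0).map p = ((homologyFunctor A 0).map p ≫
      (singleFunctorCompHomologyFunctorIso A 0).hom.app S₃) ≫
        (singleFunctorCompHomologyFunctorIso A 0).inv.app S₃ := by simp
    rw [e]
    exact epi_comp _ _
  obtain ⟨U, q, r, hU⟩ := distinguished_cocone_triangle₁ p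
  obtain ⟨V, g', k', hV⟩ := distinguished_cocone_triangle (q ≫ f)
  let o := someOctahedron rfl hU hT hV
  refine ⟨U, V, ⟨fun i hi => ?_, ?_⟩, ⟨fun i hi => ?_, ?_⟩, q ≫ f, g', k', hV⟩
  · refine (HomologySequence.exact₁ _ hU (i - 1) i (by lia)).isZero_X₂ ?_
      ((isZero_of_isLE B 0 i hi).eq_of_tgt _ _)
    -- Only for i = 1 can the homology of `S₃` reach that of `U`; there surjectivity of H⁰(p) is
    -- needed.
    by_cases h1 : i = 1
    · subst h1
      exact (HomologySequence.epi_homologyMap_mor₂_iff _ hU 0 1 rfl).1 hpe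
    · exact (isZero_homology_single S₃ 0 (i - 1) (by lia)).eq_of_src _ _
  · have hq : Mono ((homologyFunctor A 0).map q) :=
      (HomologySequence.mono_homologyMap_mor₁_iff _ hU (-1) 0 rfl).2
        ((isZero_homology_single S₃ 0 (-1) (by lia)).eq_of_src _ _)
    have hqp : (homologyFunctor A 0).map q ≫ (homologyFunctor A 0).map p = 0 := by
      have : q ≫ p = 0 := comp_distTriang_mor_zero₁₂ _ hU
      rw [← Functor.map_comp, this, Functor.map_zero]
    have hex : (ShortComplex.mk _ _ hqp).Exact := HomologySequence.exact₂ _ hU 0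
    have hap : a ≫ (homologyFunctor A 0).map p = 0 := by
      rw [← cancel_mono ((singleFunctorCompHomologyFunctorIso A 0).hom.app S₃), Category.assoc, hp,
        zero, zero_comp]
    have hqb : (homologyFunctor A 0).map q ≫ b = 0 := by
      rw [← hp, reassoc_of% hqp, zero_comp]
    have := h.torsion_iso
    have : Mono (ShortComplex.mk _ _ hqp).f := hq
    have := hS.mono_f
    -- Both `S₁` and H⁰(U) are kernels of H⁰(B) → S₃.
    refine T.prop_of_iso (X := S₁) ⟨hex.lift a hap, hS.exact.lift _ hqb, ?_, ?_⟩ h₁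
    · rw [← cancel_mono a, Category.assoc]
      erw [hS.exact.lift_f, hex.lift_f]
      simp
    · rw [← cancel_mono ((homologyFunctor A 0).map q), Category.assoc]
      erw [hex.lift_f, hS.exact.lift_f]
      simp
  · exact (HomologySequence.exact₂ _ o.mem i).isZero_X₂
      ((isZero_homology_single S₃ 0 i (by lia)).eq_of_src _ _)
      ((isZero_of_isGE Y 1 i (by lia)).eq_of_tgt _ _)
  · have := h.free_iso
    have : Mono ((homologyFunctor A 0).map o.m₁) :=
      (HomologySequence.mono_homologyMap_mor₁_iff _ o.mem (-1) 0 rfl).2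
        ((isZero_of_isGE Y 1 (-1) (by lia)).eq_of_src _ _)
    have : Epi ((homologyFunctor A 0).map o.m₁) :=
      (HomologySequence.epi_homologyMap_mor₁_iff _ o.mem 0).2
        ((isZero_of_isGE Y 1 0 (by lia)).eq_of_tgt _ _)
    have := isIso_of_mono_of_epi ((homologyFunctor A 0).map o.m₁)
    exact F.prop_of_iso (((singleFunctorCompHomologyFunctorIso A 0).app S₃).symm ≪≫
      asIso ((homologyFunctor A 0).map o.m₁)) h₃

/-- The Happel-Reiten-Smalø tilt of the standard t-structure at a torsion pair. -/
noncomputable def tilt : TStructure (DerivedCategory A) where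
  le n X := (∀ i : ℤ, n < i → IsZero ((homologyFunctor A i).obj X)) ∧
    T ((homologyFunctor A n).obj X)
  ge n X := (∀ i : ℤ, i < n - 1 → IsZero ((homologyFunctor A i).obj X)) ∧
    F ((homologyFunctor A (n - 1)).obj X)
  le_isClosedUnderIsomorphisms n := ⟨fun e hX =>
    ⟨fun i hi => (hX.1 i hi).of_iso ((homologyFunctor A i).mapIso e.symm),
      have := h.torsion_iso; T.prop_of_iso ((homologyFunctor A n).mapIso e) hX.2⟩⟩
  ge_isClosedUnderIsomorphisms n := ⟨fun e hX =>
    ⟨fun i hi => (hX.1 i hi).of_iso ((homologyFunctor A i).mapIso e.symm),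
      have := h.free_iso; F.prop_of_iso ((homologyFunctor A (n - 1)).mapIso e) hX.2⟩⟩
  le_shift n a n' hn X hX :=
    ⟨fun i hi => (hX.1 (a + i) (by lia)).of_iso
      (((homologyFunctor A 0).shiftIso a i (a + i) rfl).app X),
      have := h.torsion_iso
      T.prop_of_iso (((homologyFunctor A 0).shiftIso a n' n hn).app X).symm hX.2⟩
  ge_shift n a n' hn X hX :=
    ⟨fun i hi => (hX.1 (a + i) (by lia)).of_iso
      (((homologyFunctor A 0).shiftIso a i (a + i) rfl).app X),
      have := h.free_iso
      F.prop_of_iso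
        (((homologyFunctor A 0).shiftIso a (n' - 1) (n - 1) (by lia)).app X).symm hX.2⟩
  zero' X Y f hX hY := by
    have : X.IsLE 0 := (isLE_iff X 0).2 hX.1
    have : Y.IsGE 0 := (isGE_iff Y 0).2 fun i hi => hY.1 i (by lia)
    exact hom_eq_zero_of_homologyMap_eq_zero 0 f (h.hom_eq_zero hX.2 hY.2 _)
  le_zero_le X hX := ⟨fun i hi => hX.1 i (by lia), h.torsion_of_isZero (hX.1 1 (by lia))⟩
  ge_one_le X hX := ⟨fun i hi => hX.1 i (by lia), h.free_of_isZero (hX.1 (0 - 1) (by lia))⟩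
  exists_triangle_zero_one X := by
    obtain ⟨U, V, hU, hV, f, g, k, hT⟩ := h.exists_triangle X
    exact ⟨U, V, hU, ⟨fun i hi => hV.1 i (by lia), hV.2⟩, f, g, k, hT⟩

lemma tilt_le_iff (n : ℤ) (X : DerivedCategory A) : h.tilt.le n X ↔
    (∀ i : ℤ, n < i → IsZero ((homologyFunctor A i).obj X)) ∧
      T ((homologyFunctor A n).obj X) := Iff.rfl

lemma tilt_ge_iff (n m : ℤ) (hm : m + 1 = n) (X : DerivedCategory A) : h.tilt.ge n X ↔
    (∀ i : ℤ, i < m → IsZero ((homologyFunctor A i).obj X)) ∧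
      F ((homologyFunctor A m).obj X) := by
  obtain rfl : m = n - 1 := by lia
  rfl

lemma isHRSTilt_tilt : IsHRSTilt T F h.tilt where
  aisle X := h.tilt_le_iff 0 X
  coaisle X := h.tilt_ge_iff 0 (-1) rfl X

end IsTorsionPair

end HRSTilt

/-! ### Morphisms from a shifted projective P: Hom(P[-n], X) = Hom(P, Hⁿ(X)). -/

section Projective

namespace DerivedCategory

variable {A : Type u} [Category.{v} A] [Abelian A] [HasDerivedCategory.{w} A]

/-- P in degree `n` is K-projective, so the morphism comes from a chain map into a complex that is
zero in degree `n`. -/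
lemma hom_from_projective_eq_zero {P : A} [Projective P] (n m : ℤ) (hm : m < n)
    {X : DerivedCategory A} [X.IsLE m] (f : (singleFunctor A n).obj P ⟶ X) : f = 0 := by
  obtain ⟨K, _, ⟨e⟩⟩ := exists_iso_Q_obj_of_isLE X m
  let S : CochainComplex A ℤ := (HomologicalComplex.single A (ComplexShape.up ℤ) n).obj P
  have : S.IsStrictlyLE n := by
    rw [CochainComplex.isStrictlyLE_iff]
    intro i hi
    exact HomologicalComplex.isZero_single_obj_X _ _ _ _ (by lia)
  have (i : ℤ) : Projective (S.X i) := by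
    by_cases h : i = n
    · subst h
      exact Projective.of_iso
        (HomologicalComplex.singleObjXSelf (ComplexShape.up ℤ) i P).symm inferInstance
    · exact (HomologicalComplex.isZero_single_obj_X (ComplexShape.up ℤ) n P i h).projective
  have : S.IsKProjective := CochainComplex.isKProjective_of_projective S n
  obtain ⟨g, hg⟩ := (CochainComplex.IsKProjective.Qh_map_bijective S
    ((HomotopyCategory.quotient _ _).obj K)).surjective
      ((quotientCompQhIso A).hom.app S ≫ f ≫ e.hom ≫ (quotientCompQhIso A).inv.app K)
  obtain ⟨g', rfl⟩ := (HomotopyCategory.quotient _ _).map_surjective g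
  have hg' : g' = 0 := HomologicalComplex.from_single_hom_ext
    ((K.isZero_of_isStrictlyLE m n hm).eq_of_tgt _ _)
  rw [hg', Functor.map_zero, Functor.map_zero] at hg
  have hg₀ : f ≫ e.hom ≫ (quotientCompQhIso A).inv.app K = 0 := by
    refine (cancel_epi ((quotientCompQhIso A).hom.app S)).1 ?_
    exact hg.symm.trans comp_zero.symm
  have : IsIso (e.hom ≫ (quotientCompQhIso A).inv.app K) := inferInstance
  exact (cancel_mono (e.hom ≫ (quotientCompQhIso A).inv.app K)).1 (by rw [hg₀, zero_comp])

/-- The morphism `P ⟶ Hⁿ(X)` corresponding to a morphism `P[-n] ⟶ X`. -/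
noncomputable def fromSingle {P : A} {n : ℤ} {X : DerivedCategory A}
    (f : (singleFunctor A n).obj P ⟶ X) : P ⟶ (homologyFunctor A n).obj X :=
  (singleFunctorCompHomologyFunctorIso A n).inv.app P ≫ (homologyFunctor A n).map f

lemma fromSingle_comp {P : A} {n : ℤ} {X Y : DerivedCategory A}
    (f : (singleFunctor A n).obj P ⟶ X) (g : X ⟶ Y) :
    fromSingle (f ≫ g) = fromSingle f ≫ (homologyFunctor A n).map g := by
  simp [fromSingle]

lemma fromSingle_map_comp {P P' : A} {n : ℤ} {X : DerivedCategory A} (p : P' ⟶ P)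
    (f : (singleFunctor A n).obj P ⟶ X) :
    fromSingle ((singleFunctor A n).map p ≫ f) = p ≫ fromSingle f := by
  have := (singleFunctorCompHomologyFunctorIso A n).inv.naturality p
  dsimp at this
  simp [fromSingle, reassoc_of% this]

/-- The composite to the truncation in degrees ≥ n is detected by Hⁿ, so `f` lifts to the truncation
in degrees < n, which receives no nonzero map from P[-n]. -/
lemma eq_zero_of_fromSingle_eq_zero {P : A} [Projective P] {n : ℤ} {X : DerivedCategory A}
    (f : (singleFunctor A n).obj P ⟶ X) (hf : fromSingle f = 0) : f = 0 := by
  have hf' : (homologyFunctor A n).map f = 0 := by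
    rw [← cancel_epi ((singleFunctorCompHomologyFunctorIso A n).inv.app P), comp_zero]
    exact hf
  have h₀ : f ≫ (TStructure.t.truncGEπ n).app X = 0 :=
    hom_eq_zero_of_homologyMap_eq_zero n _ (by rw [Functor.map_comp, hf', zero_comp])
  obtain ⟨g, hg⟩ : ∃ g : _ ⟶ (TStructure.t.truncLT n).obj X,
      f = g ≫ (TStructure.t.truncLTι n).app X := Triangle.coyoneda_exact₂ _
    (TStructure.t.triangleLTGE_distinguished n X) f h₀
  have : ((TStructure.t.truncLT n).obj X).IsLE (n - 1) := inferInstance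
  have hg₀ : g = 0 := hom_from_projective_eq_zero n (n - 1) (by lia)
    (X := (TStructure.t.truncLT n).obj X) g
  rw [hg, hg₀, zero_comp]

lemma isIso_homology_truncLTι (X : DerivedCategory A) (n : ℤ) :
    IsIso ((homologyFunctor A n).map ((TStructure.t.truncLTι (n + 1)).app X)) := by
  have hT := TStructure.t.triangleLTGE_distinguished (n + 1) X
  have : Mono ((homologyFunctor A n).map ((TStructure.t.truncLTι (n + 1)).app X)) :=
    (HomologySequence.mono_homologyMap_mor₁_iff _ hT (n - 1) n (by lia)).2
      ((isZero_of_isGE ((TStructure.t.truncGE (n + 1)).obj X) (n + 1) (n - 1)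
        (by lia)).eq_of_src _ _)
  have : Epi ((homologyFunctor A n).map ((TStructure.t.truncLTι (n + 1)).app X)) :=
    (HomologySequence.epi_homologyMap_mor₁_iff _ hT n).2
      ((isZero_of_isGE ((TStructure.t.truncGE (n + 1)).obj X) (n + 1) n
        (by lia)).eq_of_tgt _ _)
  exact isIso_of_mono_of_epi _

lemma exists_fromSingle_eq {P : A} [Projective P] {n : ℤ} {X : DerivedCategory A}
    (ψ : P ⟶ (homologyFunctor A n).obj X) :
    ∃ f : (singleFunctor A n).obj P ⟶ X, fromSingle f = ψ := by
  let Y := (TStructure.t.truncLT (n + 1)).obj X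
  let ι : Y ⟶ X := (TStructure.t.truncLTι (n + 1)).app X
  have : IsIso ((homologyFunctor A n).map ι) := isIso_homology_truncLTι X n
  have : Y.IsLE n := inferInstanceAs (((TStructure.t.truncLT (n + 1)).obj X).IsLE n)
  have := isLE_truncGE Y n
  let π : Y ⟶ (TStructure.t.truncGE n).obj Y := (TStructure.t.truncGEπ n).app Y
  have : IsIso ((homologyFunctor A n).map π) := isIso_homology_truncGEπ Y n
  obtain ⟨M, ⟨e⟩⟩ :=
    exists_iso_singleFunctor_obj_of_isGE_of_isLE ((TStructure.t.truncGE n).obj Y) n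
  let χ : P ⟶ M := ψ ≫ inv ((homologyFunctor A n).map ι) ≫ (homologyFunctor A n).map π ≫
      (homologyFunctor A n).map e.hom ≫ (singleFunctorCompHomologyFunctorIso A n).hom.app M
  -- The obstruction to lifting along `π` lies in maps from P[-n] to this object, which sits in
  -- degrees below `n`.
  have h₁ : (((TStructure.t.truncLT n).obj Y)⟦(1 : ℤ)⟧).IsLE (n - 2) :=
    TStructure.t.isLE_shift ((TStructure.t.truncLT n).obj Y) (n - 1) 1 (n - 2)
  obtain ⟨g, hg⟩ : ∃ g : _ ⟶ Y, (singleFunctor A n).map χ ≫ e.inv = g ≫ π :=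
    Triangle.coyoneda_exact₃ _ (TStructure.t.triangleLTGE_distinguished n Y) _
      (hom_from_projective_eq_zero n (n - 2) (by lia)
        (X := ((TStructure.t.truncLT n).obj Y)⟦(1 : ℤ)⟧) _)
  refine ⟨g ≫ ι, ?_⟩
  have h₂ : fromSingle g ≫ (homologyFunctor A n).map π =
      χ ≫ (singleFunctorCompHomologyFunctorIso A n).inv.app M ≫
        (homologyFunctor A n).map e.inv := by
    rw [← fromSingle_comp, ← hg, fromSingle_map_comp]
    rfl
  have h₃ : fromSingle g = ψ ≫ inv ((homologyFunctor A n).map ι) := by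
    rw [← cancel_mono ((homologyFunctor A n).map π), h₂]
    simp [χ, ← Functor.map_comp]
  rw [fromSingle_comp, h₃]
  simp

end DerivedCategory

end Projective

/-! ### Products in the derived category of an abelian category with exact products. -/

section Products

namespace CochainComplex

variable {A : Type u} [Category.{v} A] [Abelian A] {J : Type t} [HasProductsOfShape J A]

/-- The termwise product of a family of cochain complexes. -/
noncomputable def prod (K : J → CochainComplex A ℤ) : CochainComplex A ℤ where
  X i := ∏ᶜ fun j => (K j).X i
  d i k := Limits.Pi.map fun j => (K j).d i k
  shape i k h := by
    ext j
    simp [(K j).shape i k h]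
  d_comp_d' i k l _ _ := by
    ext j
    simp

/-- The projections of a termwise product. -/
noncomputable def prodπ (K : J → CochainComplex A ℤ) (j : J) : prod K ⟶ K j where
  f i := Limits.Pi.π (fun j => (K j).X i) j
  comm' i k _ := by simp [prod]

/-- The morphism to a termwise product induced by a family of morphisms. -/
noncomputable def prodLift (K : J → CochainComplex A ℤ) {L : CochainComplex A ℤ}
    (f : ∀ j, L ⟶ K j) : L ⟶ prod K where
  f i := Limits.Pi.lift fun j => (f j).f i
  comm' i k _ := by
    dsimp [prod]
    ext j
    simp

/-- The termwise product of a family of morphisms. -/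
noncomputable def prodMap {K L : J → CochainComplex A ℤ} (f : ∀ j, K j ⟶ L j) :
    prod K ⟶ prod L where
  f i := Limits.Pi.map fun j => (f j).f i
  comm' i k _ := by
    dsimp [prod]
    ext j
    simp

@[simp]
lemma prodLift_π (K : J → CochainComplex A ℤ) {L : CochainComplex A ℤ}
    (f : ∀ j, L ⟶ K j) (j : J) : prodLift K f ≫ prodπ K j = f j := by
  ext i
  exact Limits.Pi.lift_π _ _

@[simp]
lemma prodMap_π {K L : J → CochainComplex A ℤ} (f : ∀ j, K j ⟶ L j) (j : J) :
    prodMap f ≫ prodπ L j = prodπ K j ≫ f j := by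
  ext i
  exact Limits.Pi.map_π (fun j => (f j).f i) j

lemma prod_X_ext {K : J → CochainComplex A ℤ} {X : A} {i : ℤ} {f g : X ⟶ (prod K).X i}
    (h : ∀ j, f ≫ (prodπ K j).f i = g ≫ (prodπ K j).f i) : f = g :=
  Limits.Pi.hom_ext _ _ h

lemma exists_prod_X_lift {K : J → CochainComplex A ℤ} {X : A} {i : ℤ}
    (f : ∀ j, X ⟶ (K j).X i) : ∃ g : X ⟶ (prod K).X i, ∀ j, g ≫ (prodπ K j).f i = f j :=
  ⟨Limits.Pi.lift f, fun _ => Limits.Pi.lift_π _ _⟩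

/-- A morphism to a product is nullhomotopic if its components are. -/
lemma homotopy_prod {K : J → CochainComplex A ℤ} {L : CochainComplex A ℤ}
    (f : L ⟶ prod K) (h : ∀ j, Homotopy (f ≫ prodπ K j) 0) : Nonempty (Homotopy f 0) := by
  choose s hs using fun i k => exists_prod_X_lift fun j => (h j).hom i k
  refine ⟨{ hom := s, zero := fun i k hik => ?_, comm := fun i => ?_ }⟩
  · refine prod_X_ext fun j => ?_
    rw [hs, (h j).zero i k hik, zero_comp]
  · refine prod_X_ext fun j => ?_
    have := (h j).comm i
    have hi : (ComplexShape.up ℤ).Rel i (i + 1) := rfl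
    have hi' : (ComplexShape.up ℤ).Rel (i - 1) i := by simp
    rw [dNext_eq _ hi, prevD_eq _ hi'] at this ⊢
    simp only [HomologicalComplex.comp_f, HomologicalComplex.zero_f, add_zero] at this
    rw [this]
    simp [hs]
    rw [← (prodπ K j).comm, reassoc_of% hs]

/-- A family of complexes, as a complex of families. -/
def familyComplex (K : J → CochainComplex A ℤ) : CochainComplex (Discrete J ⥤ A) ℤ where
  X i := Discrete.functor fun j => (K j).X i
  d i k := Discrete.natTrans fun j => (K j.as).d i k
  shape i k h := by ext j; exact (K j.as).shape i k h
  d_comp_d' i k l _ _ := by ext j; exact (K j.as).d_comp_d i k l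

/-- A family of morphisms of complexes, as a morphism of complexes of families. -/
def familyMap {K L : J → CochainComplex A ℤ} (f : ∀ j, K j ⟶ L j) :
    familyComplex K ⟶ familyComplex L where
  f i := Discrete.natTrans fun j => (f j.as).f i
  comm' i k _ := by ext j; exact (f j.as).comm i k

omit [HasProductsOfShape J A] in
lemma quasiIso_familyMap {K L : J → CochainComplex A ℤ} (f : ∀ j, K j ⟶ L j)
    [∀ j, QuasiIso (f j)] : QuasiIso (familyMap f) := by
  rw [quasiIso_iff]
  intro i
  rw [quasiIsoAt_iff_isIso_homologyMap, NatTrans.isIso_iff_isIso_app]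
  rintro ⟨j⟩
  let F := (evaluation (Discrete J) A).obj ⟨j⟩
  have h : IsIso (HomologicalComplex.homologyMap (f j) i) := inferInstance
  exact (NatIso.isIso_map_iff (ShortComplex.homologyFunctorIso F)
    ((HomologicalComplex.shortComplexFunctor _ _ i).map (familyMap f))).1 h

/-- `prodMap f` is the exact functor `lim` applied to `familyMap f`, whose homology is computed
componentwise. -/
lemma quasiIso_prodMap [HasExactLimitsOfShape (Discrete J) A]
    {K L : J → CochainComplex A ℤ} (f : ∀ j, K j ⟶ L j)
    [∀ j, QuasiIso (f j)] : QuasiIso (prodMap f) := by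
  have := quasiIso_familyMap f
  have : PreservesFiniteColimits (lim : (Discrete J ⥤ A) ⥤ A) :=
    HasExactLimitsOfShape.preservesFiniteColimits
  have : (lim : (Discrete J ⥤ A) ⥤ A).Additive := ⟨fun {X Y f g} => by
    refine limit.hom_ext fun j => ?_
    simp [Preadditive.add_comp, Preadditive.comp_add]⟩
  have : (lim : (Discrete J ⥤ A) ⥤ A).PreservesHomology := inferInstance
  exact HomologicalComplex.quasiIso_map_of_preservesHomology (familyMap f)
    (lim : (Discrete J ⥤ A) ⥤ A)

end CochainComplex

namespace DerivedCategory

open CochainComplex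

variable {A : Type u} [Category.{v} A] [Abelian A] [HasDerivedCategory.{w} A]

lemma exists_homotopy_of_Q_map_eq_zero {K L : CochainComplex A ℤ} (g : K ⟶ L)
    (hg : Q.map g = 0) : ∃ (L' : CochainComplex A ℤ) (s : L ⟶ L') (_ : QuasiIso s),
      Nonempty (Homotopy (g ≫ s) 0) := by
  have h : Qh.map ((HomotopyCategory.quotient _ _).map g) =
      Qh.map ((HomotopyCategory.quotient _ _).map (0 : K ⟶ L)) := by
    rw [← cancel_mono ((quotientCompQhIso A).hom.app L), quotientCompQhIso_hom_naturality,
      quotientCompQhIso_hom_naturality, hg, Functor.map_zero]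
  rw [MorphismProperty.map_eq_iff_postcomp Qh (HomotopyCategory.quasiIso A (.up ℤ))] at h
  obtain ⟨L', s, hs, h⟩ := h
  obtain ⟨L', rfl⟩ := HomotopyCategory.quotient_obj_surjective L'
  obtain ⟨s, rfl⟩ := (HomotopyCategory.quotient _ _).map_surjective s
  rw [← isIso_Qh_map_iff] at hs
  have : IsIso (Q.map s) := by
    rw [← NatIso.isIso_map_iff (quotientCompQhIso A)]
    exact hs
  refine ⟨L', s, (isIso_Q_map_iff_quasiIso _ s).1 this, ⟨HomotopyCategory.homotopyOfEq _ _ ?_⟩⟩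
  rw [Functor.map_comp, h, ← Functor.map_comp, zero_comp]

variable {J : Type t} [HasProductsOfShape J A] [HasExactLimitsOfShape (Discrete J) A]

/-- Calculus of fractions: represent each component by a fraction; the product of the denominators
is again a quasi-isomorphism, so one fraction represents all components. For uniqueness, the
quasi-isomorphisms that kill the components up to homotopy are multiplied in the same way. -/
lemma existsUnique_lift (K : J → CochainComplex A ℤ) (X : DerivedCategory A)
    (f : ∀ j, X ⟶ Q.obj (K j)) : ∃! g : X ⟶ Q.obj (prod K), ∀ j, g ≫ Q.map (prodπ K j) = f j := by
  refine existsUnique_of_exists_of_unique ?_ ?_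
  · obtain ⟨L, ⟨e⟩⟩ : ∃ L, Nonempty (Q.obj L ≅ X) := ⟨_, ⟨Q.objObjPreimageIso X⟩⟩
    choose Y a s hs h using fun j => left_fac (e.hom ≫ f j)
    have (j : J) : QuasiIso (s j) := (isIso_Q_map_iff_quasiIso _ _).1 (hs j)
    have := quasiIso_prodMap s
    refine ⟨e.inv ≫ Q.map (prodLift Y a) ≫ inv (Q.map (prodMap s)), fun j => ?_⟩
    have h₁ : inv (Q.map (prodMap s)) ≫ Q.map (prodπ K j) = Q.map (prodπ Y j) ≫ inv (Q.map (s j)) := by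
      rw [IsIso.inv_comp_eq, ← Functor.map_comp_assoc, prodMap_π, Functor.map_comp, Category.assoc,
        IsIso.hom_inv_id, Category.comp_id]
    rw [Category.assoc, Category.assoc, h₁, ← Functor.map_comp_assoc, prodLift_π, ← h]
    simp
  · suffices ∀ g : X ⟶ Q.obj (prod K), (∀ j, g ≫ Q.map (prodπ K j) = 0) → g = 0 by
      intro g₁ g₂ h₁ h₂
      rw [← sub_eq_zero]
      exact this _ fun j => by rw [Preadditive.sub_comp, h₁, h₂, sub_self]
    intro g hg
    obtain ⟨L, ⟨e⟩⟩ : ∃ L, Nonempty (Q.obj L ≅ X) := ⟨_, ⟨Q.objObjPreimageIso X⟩⟩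
    obtain ⟨X', s, _, a, ha⟩ := right_fac (e.hom ≫ g)
    have h₀ (j : J) : Q.map (a ≫ prodπ K j) = 0 := by
      rw [← cancel_epi (inv (Q.map s)), Functor.map_comp, ← Category.assoc, ← ha,
        Category.assoc, hg]
      simp
    choose L' t' ht' H using fun j => exists_homotopy_of_Q_map_eq_zero _ (h₀ j)
    have := quasiIso_prodMap t'
    have h₁ : Q.map (a ≫ prodMap t') = Q.map 0 := Q_map_eq_of_homotopy _
      (homotopy_prod (a ≫ prodMap t') fun j => (Homotopy.ofEq (by simp)).trans (H j).some).some
    have h₂ : Q.map a = 0 := by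
      rw [← cancel_mono (Q.map (prodMap t')), ← Functor.map_comp, h₁]
      simp
    rw [← cancel_epi e.hom, ha, h₂]
    simp

instance hasProductsOfShape : HasProductsOfShape J (DerivedCategory A) := by
  suffices ∀ X : J → DerivedCategory A, HasProduct X from
    ⟨fun F => hasLimit_of_iso (Discrete.natIsoFunctor (F := F)).symm⟩
  intro X
  let K (j : J) := Q.objPreimage (X j)
  let e (j : J) : Q.obj (K j) ≅ X j := Q.objObjPreimageIso (X j)
  choose l hl hu using fun (Z : DerivedCategory A) f => existsUnique_lift K Z f
  exact ⟨⟨⟨Fan.mk (Q.obj (prod K)) fun j => Q.map (prodπ K j) ≫ (e j).hom,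
    Fan.IsLimit.mk _ (fun s => l _ fun j => s.proj j ≫ (e j).inv)
      (fun s j => by
        dsimp
        rw [reassoc_of% hl _ (fun j => s.proj j ≫ (e j).inv) j]
        simp)
      (fun s m hm => hu _ _ _ fun j => by simp [← hm j])⟩⟩⟩

end DerivedCategory

end Products

/-! ### A criterion for AET4* via products of conflations. -/

section Criterion

variable {D : Type u} [Category.{v} D]

namespace CategoryTheory.ObjectProperty

/-- The morphisms `p i : X ⟶ F i` exhibit `X` as a product of the `F i` in the full subcategory
attached to `P`. -/
def IsProductIn (P : ObjectProperty D) {I : Type t} (X : D) (F : I → D)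
    (p : ∀ i, X ⟶ F i) : Prop :=
  P X ∧ ∀ ⦃Y : D⦄, P Y → ∀ f : ∀ i, Y ⟶ F i, ∃! g : Y ⟶ X, ∀ i, g ≫ p i = f i

lemma IsProductIn.hom_ext {P : ObjectProperty D} {I : Type t} {X : D} {F : I → D}
    {p : ∀ i, X ⟶ F i} (h : P.IsProductIn X F p) {Y : D} (hY : P Y) {f g : Y ⟶ X}
    (hfg : ∀ i, f ≫ p i = g ≫ p i) : f = g :=
  (h.2 hY fun i => g ≫ p i).unique hfg fun _ => rfl

lemma isProductIn_sigma (P : ObjectProperty D) {I : Type t} (B : I → P.FullSubcategoryᵒᵖ)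
    [HasCoproduct B] : P.IsProductIn (∐ B).unop.obj (fun i => (B i).unop.obj)
      (fun i => (Sigma.ι B i).unop.hom) := by
  refine ⟨(∐ B).unop.property, fun Y hY f => ⟨(Limits.Sigma.desc (f := B) (P := op ⟨Y, hY⟩) (fun i =>
    (P.homMk (f i) : (⟨Y, hY⟩ : P.FullSubcategory) ⟶ (B i).unop).op) :
      ∐ B ⟶ op ⟨Y, hY⟩).unop.hom, ?_, ?_⟩⟩
  · intro i
    exact congrArg (fun f => f.unop.hom) (Limits.Sigma.ι_desc (f := B) (P := op ⟨Y, hY⟩) (fun i =>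
      (P.homMk (f i) : (⟨Y, hY⟩ : P.FullSubcategory) ⟶ (B i).unop).op) i)
  · intro g hg
    refine congrArg (fun f => f.unop.hom) (show (P.homMk g :
      (⟨Y, hY⟩ : P.FullSubcategory) ⟶ (∐ B).unop).op = _ from Limits.Sigma.hom_ext _ _ fun i => ?_)
    rw [Limits.Sigma.ι_desc]
    apply Quiver.Hom.unop_inj
    ext
    exact hg i

lemma hasCoproductsOfShape_op {P : ObjectProperty D} {I : Type t}
    (h : ∀ F : I → D, (∀ i, P (F i)) → ∃ (X : D) (p : ∀ i, X ⟶ F i), P.IsProductIn X F p) :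
    HasCoproductsOfShape I P.FullSubcategoryᵒᵖ := by
  suffices ∀ B : I → P.FullSubcategoryᵒᵖ, HasCoproduct B from
    ⟨fun F => hasColimit_of_iso (Discrete.natIsoFunctor (F := F))⟩
  intro B
  obtain ⟨X, p, hX, hp⟩ := h (fun i => (B i).unop.obj) fun i => (B i).unop.property
  choose l hl hu using fun (Z : P.FullSubcategory) f => hp Z.property f
  refine ⟨⟨⟨Cofan.mk (op (⟨X, hX⟩ : P.FullSubcategory)) fun i =>
    (P.homMk (p i) : (⟨X, hX⟩ : P.FullSubcategory) ⟶ (B i).unop).op,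
    Cofan.IsColimit.mk _ (fun s => (P.homMk (l s.pt.unop fun i => (s.inj i).unop.hom) :
      s.pt.unop ⟶ (⟨X, hX⟩ : P.FullSubcategory)).op) (fun s i => ?_) (fun s m hm => ?_)⟩⟩⟩
  · apply Quiver.Hom.unop_inj
    ext
    exact hl s.pt.unop (fun i => (s.inj i).unop.hom) i
  · apply Quiver.Hom.unop_inj
    ext
    exact hu s.pt.unop _ m.unop.hom fun i => congrArg (fun f => f.unop.hom) (hm i)

variable [Preadditive D] [HasZeroObject D] [HasShift D ℤ]
  [∀ n : ℤ, (shiftFunctor D n).Additive] [Pretriangulated D]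
  {P : ObjectProperty D} [P.IsClosedUnderIsomorphisms] [P.IsTriangulatedClosed₂]

-- In the extension `Z` realizing δ, vanishing of the i-th component extends `p i` along X → Z. The
-- universal property, applied to `Z`, assembles these extensions into a retraction, so δ splits. No
-- product in the ambient category is needed.
omit [P.IsClosedUnderIsomorphisms] in
lemma IsProductIn.eq_zero_of_comp_shift {I : Type t} {X : D} {F : I → D} {p : ∀ i, X ⟶ F i}
    (h : P.IsProductIn X F p) {Y : D} (hY : P Y) (δ : Y ⟶ X⟦(1 : ℤ)⟧)
    (hδ : ∀ i, δ ≫ (p i)⟦(1 : ℤ)⟧' = 0) : δ = 0 := by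
  obtain ⟨Z, hZ, x, y, hT⟩ := P.distinguished_cocone_triangle₂ δ h.1 hY
  have ext (i : I) : ∃ b : Z ⟶ F i, x ≫ b = p i := by
    obtain ⟨b, hb, -⟩ := complete_distinguished_triangle_morphism₂ _ _ hT
      (contractible_distinguished (F i)) (p i) 0 (by
        change δ ≫ _ = 0 ≫ _
        exact (hδ i).trans zero_comp.symm)
    exact ⟨b, hb.trans (Category.comp_id _)⟩
  choose b hb using ext
  obtain ⟨s, hs, -⟩ := h.2 hZ b
  have hxs : x ≫ s = 𝟙 X := h.hom_ext h.1 fun i => by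
    rw [Category.assoc, hs, hb, Category.id_comp]
  have h₀ : δ ≫ x⟦(1 : ℤ)⟧' = 0 := comp_distTriang_mor_zero₃₁ _ hT
  rw [← Category.comp_id δ, ← Functor.map_id, ← hxs, Functor.map_comp, reassoc_of% h₀, zero_comp]

omit [P.IsClosedUnderIsomorphisms] in
lemma IsProductIn.hom_shift_ext {I : Type t} {X : D} {F : I → D} {p : ∀ i, X ⟶ F i}
    (h : P.IsProductIn X F p) {Y : D} (hY : P Y) {δ δ' : Y ⟶ X⟦(1 : ℤ)⟧}
    (hδ : ∀ i, δ ≫ (p i)⟦(1 : ℤ)⟧' = δ' ≫ (p i)⟦(1 : ℤ)⟧') : δ = δ' :=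
  sub_eq_zero.1 (h.eq_zero_of_comp_shift hY _ fun i => by
    rw [Preadditive.sub_comp, hδ, sub_self])

variable (hneg : ∀ ⦃X Y : D⦄, P X → P Y → ∀ f : X⟦(1 : ℤ)⟧ ⟶ Y, f = 0)

include hneg

-- A map killed by `x` comes, after shifting, from a map ΣW → Z, and these vanish by `hneg`. So
-- inflations are monic in P; the next lemma says dually that deflations are epic.
omit [P.IsClosedUnderIsomorphisms] [P.IsTriangulatedClosed₂] in
lemma eq_zero_of_comp_mor₁ {X Y Z : D} {x : X ⟶ Y} {y : Y ⟶ Z} {δ : Z ⟶ X⟦(1 : ℤ)⟧}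
    (hT : Triangle.mk x y δ ∈ distTriang D) (hZ : P Z) {W : D} (hW : P W) (s : W ⟶ X)
    (hs : s ≫ x = 0) : s = 0 := by
  obtain ⟨g, hg⟩ : ∃ g : W⟦(1 : ℤ)⟧ ⟶ Z, s⟦(1 : ℤ)⟧' = g ≫ δ :=
    Triangle.coyoneda_exact₁ _ hT (s⟦(1 : ℤ)⟧')
      (((shiftFunctor D (1 : ℤ)).map_comp s x).symm.trans (by
        rw [hs, Functor.map_zero]
        rfl))
  apply (shiftFunctor D (1 : ℤ)).map_injective
  rw [hg, hneg hW hZ g, zero_comp, Functor.map_zero]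

omit [P.IsClosedUnderIsomorphisms] [P.IsTriangulatedClosed₂] in
lemma eq_zero_of_mor₂_comp {X Y Z : D} {x : X ⟶ Y} {y : Y ⟶ Z} {δ : Z ⟶ X⟦(1 : ℤ)⟧}
    (hT : Triangle.mk x y δ ∈ distTriang D) (hX : P X) {W : D} (hW : P W) (s : Z ⟶ W)
    (hs : y ≫ s = 0) : s = 0 := by
  obtain ⟨g, hg⟩ : ∃ g : X⟦(1 : ℤ)⟧ ⟶ W, s = δ ≫ g := Triangle.yoneda_exact₃ _ hT s hs
  rw [hg, hneg hX hW g, comp_zero]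

variable (hfib : ∀ {I : Type t} {B Z A : I → D} (x : ∀ i, B i ⟶ Z i) (y : ∀ i, Z i ⟶ A i)
  (δ : ∀ i, A i ⟶ (B i)⟦(1 : ℤ)⟧), (∀ i, Triangle.mk (x i) (y i) (δ i) ∈ distTriang D) →
  (∀ i, P (B i)) → (∀ i, P (Z i)) → (∀ i, P (A i)) →
  ∀ {Z' A' : D} {p : ∀ i, Z' ⟶ Z i} {q : ∀ i, A' ⟶ A i},
  P.IsProductIn Z' Z p → P.IsProductIn A' A q → ∀ f : Z' ⟶ A',
  (∀ i, f ≫ q i = p i ≫ y i) → ∃ (K : D) (k : K ⟶ Z') (h : A' ⟶ K⟦(1 : ℤ)⟧), P K ∧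
    Triangle.mk k f h ∈ distTriang D)

include hfib

-- `hfib` provides a fibre `K` of `y'` inside P. Inflations being monic, `K` and `B'` are both
-- kernels of `y'` in P, so the triangle on `K` transports to `B'`.
omit [P.IsClosedUnderIsomorphisms] [P.IsTriangulatedClosed₂] in
lemma exists_distinguished_of_isProductIn {I : Type t} {B Z A : I → D} {x : ∀ i, B i ⟶ Z i}
    {y : ∀ i, Z i ⟶ A i} {δ : ∀ i, A i ⟶ (B i)⟦(1 : ℤ)⟧}
    (hT : ∀ i, Triangle.mk (x i) (y i) (δ i) ∈ distTriang D)
    (hB : ∀ i, P (B i)) (hZ : ∀ i, P (Z i)) (hA : ∀ i, P (A i))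
    {B' Z' A' : D} {r : ∀ i, B' ⟶ B i} {p : ∀ i, Z' ⟶ Z i} {q : ∀ i, A' ⟶ A i}
    (hB' : P.IsProductIn B' B r) (hZ' : P.IsProductIn Z' Z p) (hA' : P.IsProductIn A' A q)
    (x' : B' ⟶ Z') (y' : Z' ⟶ A') (hx : ∀ i, x' ≫ p i = r i ≫ x i)
    (hy : ∀ i, y' ≫ q i = p i ≫ y i) :
    ∃ δ' : A' ⟶ B'⟦(1 : ℤ)⟧, Triangle.mk x' y' δ' ∈ distTriang D ∧
      ∀ i, δ' ≫ (r i)⟦(1 : ℤ)⟧' = q i ≫ δ i := by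
  obtain ⟨K, k, h, hK, hTK⟩ := hfib x y δ hT hB hZ hA hZ' hA' y' hy
  have hxy (i : I) : x i ≫ y i = 0 := comp_distTriang_mor_zero₁₂ _ (hT i)
  have hky : k ≫ y' = 0 := comp_distTriang_mor_zero₁₂ _ hTK
  have hxy' : x' ≫ y' = 0 := hA'.hom_ext hB'.1 fun i => by
    rw [Category.assoc, hy, reassoc_of% hx, hxy, comp_zero, zero_comp]
  obtain ⟨a, ha⟩ : ∃ a : B' ⟶ K, x' = a ≫ k := Triangle.coyoneda_exact₂ _ hTK x' hxy'
  have hv (i : I) : ∃ v : K ⟶ B i, k ≫ p i = v ≫ x i :=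
    Triangle.coyoneda_exact₂ _ (hT i) (k ≫ p i) (by
      change (k ≫ p i) ≫ y i = 0
      rw [Category.assoc, ← hy, reassoc_of% hky, zero_comp])
  choose v hv using hv
  obtain ⟨b, hb, -⟩ := hB'.2 hK v
  have hbx : b ≫ x' = k := hZ'.hom_ext hK fun i => by
    rw [Category.assoc, hx, reassoc_of% hb, hv]
  have hab : a ≫ b = 𝟙 B' := hB'.hom_ext hB'.1 fun i => by
    rw [← sub_eq_zero]
    refine eq_zero_of_comp_mor₁ hneg (hT i) (hA i) hB'.1 _ ?_
    rw [Preadditive.sub_comp, Category.id_comp, Category.assoc, Category.assoc, reassoc_of% hb,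
      ← hv, ← Category.assoc, ← ha, hx, sub_self]
  have hba : b ≫ a = 𝟙 K := by
    rw [← sub_eq_zero]
    refine eq_zero_of_comp_mor₁ hneg hTK hA'.1 hK _ ?_
    rw [Preadditive.sub_comp, Category.id_comp, Category.assoc, ← ha, hbx, sub_self]
  have hT' : Triangle.mk x' y' (h ≫ b⟦(1 : ℤ)⟧') ∈ distTriang D := by
    refine isomorphic_distinguished _ hTK _ (Triangle.isoMk _ _ ⟨a, b, hab, hba⟩ (Iso.refl _)
      (Iso.refl _) ?_ ?_ ?_)
    · change x' ≫ 𝟙 _ = a ≫ k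
      rw [Category.comp_id, ha]
    · change y' ≫ 𝟙 _ = 𝟙 _ ≫ y'
      rw [Category.comp_id, Category.id_comp]
    · change (h ≫ b⟦(1 : ℤ)⟧') ≫ a⟦(1 : ℤ)⟧' = 𝟙 _ ≫ h
      rw [Category.assoc, ← Functor.map_comp, hba, Functor.map_id, Category.comp_id,
        Category.id_comp]
  refine ⟨_, hT', fun i => ?_⟩
  obtain ⟨f, hf₁, hf₂⟩ : ∃ f : A' ⟶ A i, y' ≫ f = p i ≫ y i ∧
      (h ≫ b⟦(1 : ℤ)⟧') ≫ (r i)⟦(1 : ℤ)⟧' = f ≫ δ i :=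
    complete_distinguished_triangle_morphism _ _ hT' (hT i) (r i) (p i) (hx i)
  -- The completed morphism of triangles is only known to exist; `y'` being epic in P forces its
  -- third component.
  have : f = q i := by
    rw [← sub_eq_zero]
    refine eq_zero_of_mor₂_comp hneg hT' hB'.1 (hA i) _ ?_
    rw [Preadditive.comp_sub, hf₁, hy, sub_self]
  rw [hf₂, this]

/-- A criterion for an extension-closed subcategory without negative self-extensions of degree
`-1` to be AET4*. -/
theorem isAET4Star_of_products [P.ContainsZero] [IsTriangulated D]
    (hprod : ∀ (I : Type t) (F : I → D), (∀ i, P (F i)) →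
      ∃ (X : D) (p : ∀ i, X ⟶ F i), P.IsProductIn X F p) :
    P.extriangulated.IsAET4Star.{t} := by
  intro I _
  have hI := hasCoproductsOfShape_op (hprod I)
  refine ⟨hI, ?_⟩
  have key (B : I → P.FullSubcategoryᵒᵖ) (A : P.FullSubcategoryᵒᵖ)
      (η : ∀ i, A.unop.obj ⟶ (B i).unop.obj⟦(1 : ℤ)⟧) (Z : I → P.FullSubcategoryᵒᵖ)
      (x : ∀ i, A ⟶ Z i) (y : ∀ i, Z i ⟶ B i)
      (hT : ∀ i, Triangle.mk (y i).unop.hom (x i).unop.hom (η i) ∈ distTriang D) :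
      ∃ δ : (∐ fun _ : I => A).unop.obj ⟶ (∐ B).unop.obj⟦(1 : ℤ)⟧,
        Triangle.mk (Limits.Sigma.map y).unop.hom (Limits.Sigma.map x).unop.hom δ ∈
          distTriang D ∧
        ∀ i, δ ≫ (Sigma.ι B i).unop.hom⟦(1 : ℤ)⟧' =
          (Sigma.ι (fun _ : I => A) i).unop.hom ≫ η i :=
    exists_distinguished_of_isProductIn hneg hfib hT (fun i => (B i).unop.property)
      (fun i => (Z i).unop.property) (fun _ => A.unop.property) (P.isProductIn_sigma B)
      (P.isProductIn_sigma Z) (P.isProductIn_sigma fun _ : I => A) _ _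
      (fun i => congrArg (fun f => f.unop.hom) (Sigma.ι_map y i))
      (fun i => congrArg (fun f => f.unop.hom) (Sigma.ι_map x i))
  have ex (B : I → P.FullSubcategoryᵒᵖ) (A : P.FullSubcategoryᵒᵖ)
      (η : ∀ i, A.unop.obj ⟶ (B i).unop.obj⟦(1 : ℤ)⟧) :
      ∃ δ : (∐ fun _ : I => A).unop.obj ⟶ (∐ B).unop.obj⟦(1 : ℤ)⟧,
        ∀ i, δ ≫ (Sigma.ι B i).unop.hom⟦(1 : ℤ)⟧' =
          (Sigma.ι (fun _ : I => A) i).unop.hom ≫ η i := by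
    -- The middle terms are arbitrary: `uniq` below shows that δ depends only on its components.
    choose Z hZ y x hT using fun i => P.distinguished_cocone_triangle₂ (η i)
      (B i).unop.property A.unop.property
    obtain ⟨δ, -, h⟩ := key B A η (fun i => op ⟨Z i, hZ i⟩)
      (fun i => (P.homMk (x i) : (⟨Z i, hZ i⟩ : P.FullSubcategory) ⟶ A.unop).op)
      (fun i => (P.homMk (y i) : (B i).unop ⟶ (⟨Z i, hZ i⟩ : P.FullSubcategory)).op) hT
    exact ⟨δ, h⟩
  choose Γ hΓ using ex
  have uniq (B : I → P.FullSubcategoryᵒᵖ) {Y : D} (hY : P Y)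
      (δ δ' : Y ⟶ (∐ B).unop.obj⟦(1 : ℤ)⟧) (h : ∀ i, δ ≫ (Sigma.ι B i).unop.hom⟦(1 : ℤ)⟧' =
        δ' ≫ (Sigma.ι B i).unop.hom⟦(1 : ℤ)⟧') : δ = δ' :=
    (P.isProductIn_sigma B).hom_shift_ext hY h
  have nat (B B' : I → P.FullSubcategoryᵒᵖ) (A A' : P.FullSubcategoryᵒᵖ) (f : ∀ i, B' i ⟶ B i)
      (a : A ⟶ A') (η : ∀ i, A.unop.obj ⟶ (B i).unop.obj⟦(1 : ℤ)⟧) :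
      Γ B' A' (fun i => (a.unop.hom ≫ η i) ≫ (f i).unop.hom⟦(1 : ℤ)⟧') =
        ((Limits.Sigma.map fun _ : I => a).unop.hom ≫ Γ B A η) ≫
          (Limits.Sigma.map f).unop.hom⟦(1 : ℤ)⟧' := by
    refine uniq B' (∐ fun _ : I => A').unop.property _ _ fun i => ?_
    have h₁ : (Limits.Sigma.map f).unop.hom ≫ (Sigma.ι B' i).unop.hom =
        (Sigma.ι B i).unop.hom ≫ (f i).unop.hom :=
      congrArg (fun f => f.unop.hom) (Sigma.ι_map f i)
    have h₂ : (Limits.Sigma.map fun _ : I => a).unop.hom ≫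
        (Sigma.ι (fun _ : I => A) i).unop.hom =
        (Sigma.ι (fun _ : I => A') i).unop.hom ≫ a.unop.hom :=
      congrArg (fun f => f.unop.hom) (Sigma.ι_map (fun _ : I => a) i)
    rw [hΓ, Category.assoc, Category.assoc, Category.assoc, ← Functor.map_comp, h₁,
      Functor.map_comp, reassoc_of% hΓ B A η i, reassoc_of% h₂]
  refine ⟨fun B A => AddMonoidHom.mk' (fun η => Γ B A η) fun η η' => ?_, ?_, ?_, hΓ⟩
  · refine uniq B (∐ fun _ : I => A).unop.property _ _ fun i => ?_
    refine (hΓ B A _ i).trans ?_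
    refine (Preadditive.comp_add _ _ _ _ (η i) (η' i)).trans ?_
    refine Eq.trans ?_ (Preadditive.add_comp _ _ _ (Γ B A η) (Γ B A η') _).symm
    exact congrArg₂ _ (hΓ B A η i).symm (hΓ B A η' i).symm
  · exact fun B B' A A' f a η => nat B B' A A' f a η
  · intro B A η Z x y hT
    obtain ⟨δ, hδ, h⟩ := key B A η Z x y hT
    have : Γ B A η = δ := uniq B (∐ fun _ : I => A).unop.property _ _ fun i =>
      (hΓ B A η i).trans (h i).symm
    change Triangle.mk _ _ (Γ B A η) ∈ _
    rw [this]
    exact hδ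

end CategoryTheory.ObjectProperty

end Criterion

/-! ### Products in a heart. -/

section HeartProducts

variable {D : Type u} [Category.{v} D] [Preadditive D] [HasZeroObject D] [HasShift D ℤ]
  [∀ n : ℤ, (shiftFunctor D n).Additive] [Pretriangulated D]

namespace CategoryTheory.ObjectProperty

/-- An object with no extensions by the `B i` lifts along each `y i` separately; the product
property glues these lifts. -/
lemma IsProductIn.exists_lift {P : ObjectProperty D} {I : Type t} {B Z A : I → D}
    {x : ∀ i, B i ⟶ Z i} {y : ∀ i, Z i ⟶ A i} {δ : ∀ i, A i ⟶ (B i)⟦(1 : ℤ)⟧}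
    (hT : ∀ i, Triangle.mk (x i) (y i) (δ i) ∈ distTriang D)
    {Z' A' : D} {p : ∀ i, Z' ⟶ Z i} {q : ∀ i, A' ⟶ A i}
    (hZ' : P.IsProductIn Z' Z p) (hA' : P.IsProductIn A' A q) {f : Z' ⟶ A'}
    (hf : ∀ i, f ≫ q i = p i ≫ y i) {G : D} (hG : P G)
    (hGB : ∀ i (a : G ⟶ (B i)⟦(1 : ℤ)⟧), a = 0) (g : G ⟶ A') : ∃ g' : G ⟶ Z', g' ≫ f = g := by
  have hs (i : I) : ∃ s : G ⟶ Z i, g ≫ q i = s ≫ y i :=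
    Triangle.coyoneda_exact₃ _ (hT i) (g ≫ q i) (hGB i _)
  choose s hs using hs
  obtain ⟨g', hg', -⟩ := hZ'.2 hG s
  refine ⟨g', hA'.hom_ext hG fun i => ?_⟩
  rw [Category.assoc, hf, reassoc_of% hg' i, hs]

end CategoryTheory.ObjectProperty

/-- Maps from the aisle into the product factor uniquely through its truncation `V`. The truncation
stays in the coaisle because maps from `x.le (n - 1)` to `V` are detected on the factors `F i`,
where they vanish. -/
lemma CategoryTheory.Triangulated.TStructure.exists_isProductIn (x : TStructure D)
    (P : ObjectProperty D) (n : ℤ) (hP : ∀ X, P X ↔ x.le n X ∧ x.ge n X) {I : Type t}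
    [HasProductsOfShape I D] (F : I → D) (hF : ∀ i, P (F i)) :
    ∃ (X : D) (p : ∀ i, X ⟶ F i), P.IsProductIn X F p := by
  obtain ⟨V, W, hV, hW, a, b, c, hT⟩ := x.exists_triangle (∏ᶜ F) n (n + 1) rfl
  have zero {Y Z : D} (hY : x.le n Y) (hZ : x.ge (n + 1) Z) (f : Y ⟶ Z) : f = 0 :=
    x.zero_of_isLE_of_isGE f n (n + 1) (by lia) ⟨hY⟩ ⟨hZ⟩
  have hW' : x.ge (n + 2) (W⟦(-1 : ℤ)⟧) := x.ge_shift (n + 1) (-1) (n + 2) (by lia) W hW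
  have lift {Y : D} (hY : x.le n Y) (f : Y ⟶ ∏ᶜ F) : ∃ g : Y ⟶ V, f = g ≫ a :=
    Triangle.coyoneda_exact₂ _ hT f (zero hY hW _)
  have inj {Y : D} (hY : x.le n Y) (g : Y ⟶ V) (hg : g ≫ a = 0) : g = 0 := by
    obtain ⟨s, hs⟩ := Triangle.coyoneda_exact₂ _ (inv_rot_of_distTriang _ hT) g hg
    have hs₀ : s = 0 := zero hY (x.ge_antitone (by lia) _ hW') s
    exact hs.trans (by rw [hs₀, zero_comp]; rfl)
  have hVge : x.ge n V := by
    obtain ⟨V', W', hV', hW', a', b', c', hT'⟩ := x.exists_triangle V (n - 1) n (by lia)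
    have h₁ {Y : D} (hY : x.le (n - 1) Y) (f : Y ⟶ V) : f = 0 := by
      refine inj (x.le_monotone (by lia) _ hY) f (Limits.Pi.hom_ext _ _ fun i => ?_)
      rw [zero_comp]
      exact x.zero_of_isLE_of_isGE _ (n - 1) n (by lia) ⟨hY⟩ ⟨((hP _).1 (hF i)).2⟩
    -- As `a' = 0`, `b'` is a split mono; the complement is cut out by a map ΣV' → W', which is zero
    -- since ΣV' lies in `x.le (n - 2)`.
    have : IsIso b' := by
      have ha' : a' = 0 := h₁ hV' a'
      obtain ⟨r, hr⟩ : ∃ r : W' ⟶ V, 𝟙 V = b' ≫ r :=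
        Triangle.yoneda_exact₂ _ hT' (𝟙 V) ((Category.comp_id a').trans ha')
      refine ⟨r, hr.symm, ?_⟩
      obtain ⟨s, hs⟩ : ∃ s : V'⟦(1 : ℤ)⟧ ⟶ W', r ≫ b' - 𝟙 W' = c' ≫ s :=
        Triangle.yoneda_exact₃ _ hT' (r ≫ b' - 𝟙 W') (by
          change b' ≫ (r ≫ b' - 𝟙 W') = 0
          rw [Preadditive.comp_sub, ← Category.assoc, ← hr, Category.id_comp, Category.comp_id,
            sub_self])
      have hs₀ : s = 0 := x.zero_of_isLE_of_isGE _ (n - 2) n (by lia)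
        ⟨x.le_shift (n - 1) 1 (n - 2) (by lia) _ hV'⟩ ⟨hW'⟩
      rw [hs₀, comp_zero] at hs
      exact sub_eq_zero.1 hs
    exact (x.ge n).prop_of_iso (asIso b').symm hW'
  refine ⟨V, fun i => a ≫ Limits.Pi.π F i, (hP V).2 ⟨hV, hVge⟩, fun Y hY f => ?_⟩
  obtain ⟨g, hg⟩ := lift ((hP Y).1 hY).1 (Limits.Pi.lift f)
  refine ⟨g, fun i => ?_, fun g' hg' => ?_⟩
  · dsimp only
    rw [← Category.assoc, ← hg, Limits.Pi.lift_π]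
  · rw [← sub_eq_zero]
    refine inj ((hP Y).1 hY).1 _ (Limits.Pi.hom_ext _ _ fun i => ?_)
    rw [zero_comp, Preadditive.sub_comp, ← hg, Preadditive.sub_comp, Category.assoc, hg',
      Limits.Pi.lift_π, sub_self]

end HeartProducts

section SingleTriangle

variable {A : Type u} [Category.{v} A] [Abelian A] [HasDerivedCategory.{w} A]

lemma DerivedCategory.exists_single_triangle {S : ShortComplex A} (hS : S.ShortExact) (n : ℤ) :
    ∃ δ : (singleFunctor A n).obj S.X₃ ⟶ ((singleFunctor A n).obj S.X₁)⟦(1 : ℤ)⟧,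
      Triangle.mk ((singleFunctor A n).map S.f) ((singleFunctor A n).map S.g) δ ∈
        distTriang (DerivedCategory A) :=
  ⟨_, triangleOfSES_distinguished
    (hS.map_of_exact (HomologicalComplex.single A (ComplexShape.up ℤ) n))⟩

lemma DerivedCategory.epi_homologyMap_of_forall_isZero {X Y : DerivedCategory A} (f : X ⟶ Y)
    (n : ℤ) (h : IsZero ((homologyFunctor A n).obj Y)) : Epi ((homologyFunctor A n).map f) :=
  ⟨fun _ _ _ => h.eq_of_src _ _⟩

end SingleTriangle

/-! ### I and R/I as test objects; AET4* for the shifted hearts. -/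

section ProdRingGenerators

open DerivedCategory

/-- The torsion class `Gen(I)`. -/
abbrev torsionClass : ObjectProperty (ModuleCat.{0} ProdRing) := Gen (R := ProdRing) sumIdeal

/-- The torsion-free class `Gen(R/I)`. -/
abbrev torsionFreeClass : ObjectProperty (ModuleCat.{0} ProdRing) :=
  Gen (R := ProdRing) (ProdRing ⧸ sumIdeal)

/-- `R` as an `R`-module. -/
abbrev ringModule : ModuleCat.{0} ProdRing := ModuleCat.of ProdRing ProdRing

/-- The ideal `I` as an `R`-module. -/
abbrev idealModule : ModuleCat.{0} ProdRing := ModuleCat.of ProdRing sumIdeal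

/-- The `R`-module `R/I`. -/
abbrev quotientModule : ModuleCat.{0} ProdRing := ModuleCat.of ProdRing (ProdRing ⧸ sumIdeal)

/-- The inclusion of `I` in `R`. -/
abbrev idealInclusion : idealModule ⟶ ringModule := ModuleCat.ofHom sumIdeal.subtype

/-- The projection from `R` to `R/I`. -/
abbrev quotientProjection : ringModule ⟶ quotientModule := ModuleCat.ofHom sumIdeal.mkQ

instance : Projective ringModule :=
  (IsProjective.iff_projective ringModule).1 (inferInstanceAs (Module.Projective ProdRing ProdRing))

instance : Projective idealModule :=
  (IsProjective.iff_projective idealModule).1 projective_sumIdeal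

lemma exists_idealInclusion_shortExact :
    ∃ w, (ShortComplex.mk idealInclusion quotientProjection w).ShortExact := by
  have w : idealInclusion ≫ quotientProjection = 0 := by
    ext a
    exact (Submodule.Quotient.mk_eq_zero _).2 a.2
  refine ⟨w, { exact := ?_, mono_f := ?_, epi_g := ?_ }⟩
  · rw [ShortComplex.moduleCat_exact_iff]
    intro a ha
    exact ⟨⟨a, (Submodule.Quotient.mk_eq_zero _).1 ha⟩, rfl⟩
  · exact (ModuleCat.mono_iff_injective _).2 Subtype.val_injective
  · exact (ModuleCat.epi_iff_surjective _).2 (Submodule.mkQ_surjective _)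

variable [HasDerivedCategory.{w} (ModuleCat.{0} ProdRing)]

lemma exists_idealInclusion_triangle (n : ℤ) :
    ∃ δ : (singleFunctor _ n).obj quotientModule ⟶ ((singleFunctor _ n).obj idealModule)⟦(1 : ℤ)⟧,
      Triangle.mk ((singleFunctor _ n).map idealInclusion)
        ((singleFunctor _ n).map quotientProjection) δ ∈
        distTriang (DerivedCategory (ModuleCat.{0} ProdRing)) := by
  obtain ⟨w, hS⟩ := exists_idealInclusion_shortExact
  exact exists_single_triangle hS n

lemma hom_single_idealModule_eq_zero {n : ℤ} {X : DerivedCategory (ModuleCat.{0} ProdRing)}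
    (hX : torsionFreeClass ((homologyFunctor _ n).obj X))
    (f : (singleFunctor _ n).obj idealModule ⟶ X) : f = 0 :=
  eq_zero_of_fromSingle_eq_zero f
    (eq_zero_of_gen_sumIdeal_of_gen_quotient gen_sumIdeal_self hX _)

/-- Restricted to R, the map amounts to R → R/I → Hⁿ(X), which is zero because F maps trivially to
T. So it factors through the shifted I, where it amounts to a map I → Hᵐ(X) from T to F. -/
lemma hom_single_quotientModule_eq_zero {m n : ℤ} (hm : m + 1 = n)
    {X : DerivedCategory (ModuleCat.{0} ProdRing)}
    (h₁ : torsionFreeClass ((homologyFunctor _ m).obj X))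
    (h₂ : torsionClass ((homologyFunctor _ n).obj X))
    (f : (singleFunctor _ n).obj quotientModule ⟶ X) : f = 0 := by
  obtain ⟨δ, hT⟩ := exists_idealInclusion_triangle.{w} n
  have hf : (singleFunctor _ n).map quotientProjection ≫ f = 0 := by
    apply eq_zero_of_fromSingle_eq_zero
    rw [fromSingle_map_comp, eq_zero_of_gen_quotient_of_gen_sumIdeal gen_quotient_self h₂
      (fromSingle f), comp_zero]
  obtain ⟨g, hg⟩ : ∃ g : ((singleFunctor _ n).obj idealModule)⟦(1 : ℤ)⟧ ⟶ X, f = δ ≫ g :=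
    Triangle.yoneda_exact₃ _ hT f hf
  let e : ((singleFunctor _ n).obj idealModule)⟦(1 : ℤ)⟧ ≅ (singleFunctor _ m).obj idealModule :=
    ((singleFunctors (ModuleCat.{0} ProdRing)).shiftIso 1 m n (by lia)).app idealModule
  have hg₀ : e.inv ≫ g = 0 := hom_single_idealModule_eq_zero h₁ _
  rw [hg, (Iso.inv_comp_eq e).1 hg₀, comp_zero, comp_zero]

/-- An element `y` fixed by `e` in I is the value at `e` of the map I → Hⁿ(Y), a ↦ ay. This is
realized in the derived category because I is projective, and then lifted. -/
lemma epi_homologyMap_of_torsionClass {n : ℤ} {X Y : DerivedCategory (ModuleCat.{0} ProdRing)}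
    (f : X ⟶ Y) (hY : torsionClass ((homologyFunctor _ n).obj Y))
    (hf : ∀ g : (singleFunctor _ n).obj idealModule ⟶ Y, ∃ g', g' ≫ f = g) :
    Epi ((homologyFunctor _ n).map f) := by
  rw [ModuleCat.epi_iff_surjective]
  intro y
  obtain ⟨e, he, h⟩ := (gen_sumIdeal_iff _).1 hY y
  obtain ⟨g, hg⟩ := exists_fromSingle_eq (X := Y)
    (idealInclusion ≫ ModuleCat.ofHom (LinearMap.toSpanSingleton ProdRing _ y))
  obtain ⟨g', rfl⟩ := hf g
  rw [fromSingle_comp] at hg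
  exact ⟨fromSingle g' ⟨e, he⟩, (congrArg (fun φ => φ ⟨e, he⟩) hg).trans h⟩

/-- R/I need not be projective, so `y` is first realized by a map from R; this vanishes on I since
the homology lies in F, and so descends to R/I. -/
lemma epi_homologyMap_of_torsionFreeClass {n : ℤ}
    {X Y : DerivedCategory (ModuleCat.{0} ProdRing)}
    (f : X ⟶ Y) (hY : torsionFreeClass ((homologyFunctor _ n).obj Y))
    (hf : ∀ g : (singleFunctor _ n).obj quotientModule ⟶ Y, ∃ g', g' ≫ f = g) :
    Epi ((homologyFunctor _ n).map f) := by
  rw [ModuleCat.epi_iff_surjective]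
  intro y
  obtain ⟨δ, hT⟩ := exists_idealInclusion_triangle.{w} n
  obtain ⟨φ, hφ⟩ := exists_fromSingle_eq (X := Y) (P := ringModule)
    (ModuleCat.ofHom (LinearMap.toSpanSingleton ProdRing _ y))
  obtain ⟨g, hg⟩ : ∃ g : (singleFunctor _ n).obj quotientModule ⟶ Y,
      φ = (singleFunctor _ n).map quotientProjection ≫ g :=
    Triangle.yoneda_exact₂ _ hT φ (hom_single_idealModule_eq_zero hY _)
  obtain ⟨g', rfl⟩ := hf g
  rw [hg, ← Category.assoc, fromSingle_comp] at hφ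
  exact ⟨fromSingle ((singleFunctor _ n).map quotientProjection ≫ g') (1 : ProdRing),
    (congrArg (fun φ => φ (1 : ProdRing)) hφ).trans (one_smul _ y)⟩

/-- The Happel-Reiten-Smalø tilt at `(Gen(I), Gen(R/I))`. -/
noncomputable abbrev genTilt : TStructure (DerivedCategory (ModuleCat.{0} ProdRing)) :=
  isTorsionPair_gen.tilt

lemma genTilt_le_and_ge_iff {m n : ℤ} (hm : m + 1 = n)
    (X : DerivedCategory (ModuleCat.{0} ProdRing)) :
    genTilt.le n X ∧ genTilt.ge n X ↔
      ((∀ i, n < i → IsZero ((homologyFunctor _ i).obj X)) ∧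
        torsionClass ((homologyFunctor _ n).obj X)) ∧
      ((∀ i, i < m → IsZero ((homologyFunctor _ i).obj X)) ∧
        torsionFreeClass ((homologyFunctor _ m).obj X)) := by
  rw [IsTorsionPair.tilt_le_iff, IsTorsionPair.tilt_ge_iff _ n m hm]

lemma genTilt_single_idealModule (n : ℤ) :
    genTilt.le n ((singleFunctor _ n).obj idealModule) ∧
      genTilt.ge n ((singleFunctor _ n).obj idealModule) := by
  rw [genTilt_le_and_ge_iff (sub_add_cancel n 1)]
  exact ⟨⟨fun i hi => isZero_homology_single _ n i hi.ne',
    (gen_isClosedUnderIsomorphisms _).of_iso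
      ((singleFunctorCompHomologyFunctorIso _ n).symm.app _) gen_sumIdeal_self⟩,
    fun i hi => isZero_homology_single _ n i (by lia),
    isTorsionPair_gen.free_of_isZero (isZero_homology_single _ n _ (by lia))⟩

lemma genTilt_single_quotientModule {m n : ℤ} (hm : m + 1 = n) :
    genTilt.le n ((singleFunctor _ m).obj quotientModule) ∧
      genTilt.ge n ((singleFunctor _ m).obj quotientModule) := by
  rw [genTilt_le_and_ge_iff hm]
  exact ⟨⟨fun i hi => isZero_homology_single _ m i (by lia),
    isTorsionPair_gen.torsion_of_isZero (isZero_homology_single _ m _ (by lia))⟩,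
    fun i hi => isZero_homology_single _ m i hi.ne,
    (gen_isClosedUnderIsomorphisms _).of_iso
      ((singleFunctorCompHomologyFunctorIso _ m).symm.app _) gen_quotient_self⟩

/-- The homology of the shift of an object. -/
noncomputable def homologyShiftIso (X : DerivedCategory (ModuleCat.{0} ProdRing)) {m n : ℤ}
    (hm : m + 1 = n) :
    (homologyFunctor (ModuleCat.{0} ProdRing) n).obj X ≅
      (homologyFunctor (ModuleCat.{0} ProdRing) m).obj (X⟦(1 : ℤ)⟧) :=
  (((homologyFunctor _ 0).shiftIso 1 m n (by lia)).app X).symm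

/-- The free degree `n` serves for the heart (n = 0) and for its desuspension (n = 1). Homology is
unconstrained only by vanishing in degrees `m` and `n`, and there R/I and I respectively test
surjectivity. -/
theorem isAET4Star_of_iff_genTilt (P : ObjectProperty (DerivedCategory (ModuleCat.{0} ProdRing)))
    [P.IsClosedUnderIsomorphisms] [P.IsTriangulatedClosed₂] [P.ContainsZero] (n : ℤ)
    (hP : ∀ X, P X ↔ genTilt.le n X ∧ genTilt.ge n X) :
    P.extriangulated.IsAET4Star.{0} := by
  obtain ⟨m, hm⟩ : ∃ m : ℤ, m + 1 = n := ⟨n - 1, by lia⟩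
  have hP' (X) := (hP X).trans (genTilt_le_and_ge_iff hm X)
  have := gen_isClosedUnderIsomorphisms (R := ProdRing) sumIdeal
  have := gen_isClosedUnderIsomorphisms (R := ProdRing) (ProdRing ⧸ sumIdeal)
  refine ObjectProperty.isAET4Star_of_products ?_ ?_ ?_
  · intro X Y hX hY f
    exact genTilt.zero_of_isLE_of_isGE f (n - 1) n (by lia)
      ⟨genTilt.le_shift n 1 (n - 1) (by lia) X ((hP X).1 hX).1⟩ ⟨((hP Y).1 hY).2⟩
  · intro I B Z A x y δ hT hB hZ hA Z' A' p q hZ' hA' f hf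
    have lift {G : DerivedCategory (ModuleCat.{0} ProdRing)} (hG : P G)
        (hGB : ∀ i (a : G ⟶ (B i)⟦(1 : ℤ)⟧), a = 0) (g : G ⟶ A') : ∃ g' : G ⟶ Z', g' ≫ f = g :=
      hZ'.exists_lift hT hA' hf hG hGB g
    have hA'' := (hP' A').1 hA'.1
    have epi (i : ℤ) : Epi ((homologyFunctor _ i).map f) := by
      rcases lt_trichotomy i m with h | rfl | h
      · exact epi_homologyMap_of_forall_isZero _ _ (hA''.2.1 i h)
      · refine epi_homologyMap_of_torsionFreeClass f hA''.2.2
          (lift ((hP _).2 (genTilt_single_quotientModule hm)) fun j a => ?_)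
        have hB' := (hP' (B j)).1 (hB j)
        exact hom_single_quotientModule_eq_zero (sub_add_cancel i 1)
          (torsionFreeClass.prop_of_iso (homologyShiftIso (B j) (by lia)) hB'.2.2)
          (torsionClass.prop_of_iso (homologyShiftIso (B j) (by lia)) hB'.1.2) a
      · rcases eq_or_lt_of_le (show n ≤ i by lia) with rfl | h
        · refine epi_homologyMap_of_torsionClass f hA''.1.2
            (lift ((hP _).2 (genTilt_single_idealModule n)) fun j a => ?_)
          have hB' := (hP' (B j)).1 (hB j)
          exact hom_single_idealModule_eq_zero (isTorsionPair_gen.free_of_isZero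
            ((hB'.1.1 (n + 1) (by lia)).of_iso (homologyShiftIso (B j) rfl).symm)) a
        · exact epi_homologyMap_of_forall_isZero _ _ (hA''.1.1 i h)
    obtain ⟨K, k, h, hK⟩ := distinguished_cocone_triangle₁ f
    -- Surjectivity in all degrees kills the connecting maps, so the homology of `K` embeds in that
    -- of `Z'`, and T and F are closed under submodules.
    have mono (i : ℤ) : Mono ((homologyFunctor _ i).map k) :=
      (HomologySequence.mono_homologyMap_mor₁_iff _ hK (i - 1) i (by lia)).2
        ((HomologySequence.epi_homologyMap_mor₂_iff _ hK (i - 1) i (by lia)).1 (epi (i - 1)))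
    have hZ'' := (hP' Z').1 hZ'.1
    refine ⟨K, k, h, (hP' K).2 ⟨⟨fun i hi => ?_, ?_⟩, fun i hi => ?_, ?_⟩, hK⟩
    · exact IsZero.of_mono ((homologyFunctor _ i).map k) (hZ''.1.1 i hi)
    · exact gen_sumIdeal_of_mono ((homologyFunctor _ n).map k) hZ''.1.2
    · exact IsZero.of_mono ((homologyFunctor _ i).map k) (hZ''.2.1 i hi)
    · exact gen_quotient_of_mono ((homologyFunctor _ m).map k) hZ''.2.2
  · intro I F hF
    exact genTilt.exists_isProductIn P n hP F hF

end ProdRingGenerators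

/-! ### Failure of co-smashing and of AET4* for the extended heart. -/

section ProdRingCounterexamples

open DerivedCategory

/-- Multiplication by the `j`-th idempotent. -/
abbrev mulIdem (j : ℕ) : ringModule ⟶ ringModule :=
  ModuleCat.ofHom (LinearMap.toSpanSingleton ProdRing ProdRing (ProdRing.idem j))

/-- The component `R_j` as an `R`-module. -/
abbrev componentModule (j : ℕ) : ModuleCat.{0} ProdRing := ModuleCat.of ProdRing (componentIdeal j)

lemma idem_mem_componentIdeal (j : ℕ) : ProdRing.idem j ∈ componentIdeal j :=
  fun i hi => by simp [ProdRing.idem, hi]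

/-- The projection from `R` to its component `R_j`. -/
abbrev componentProjection (j : ℕ) : ringModule ⟶ componentModule j :=
  ModuleCat.ofHom
    (LinearMap.toSpanSingleton ProdRing (componentIdeal j) ⟨_, idem_mem_componentIdeal j⟩)

lemma torsionClass_componentModule (j : ℕ) : torsionClass (componentModule j) := by
  refine (gen_sumIdeal_iff _).2 fun a => ⟨_, idem_mem_sumIdeal j, Subtype.ext ?_⟩
  change ProdRing.idem j * a.1 = a.1
  rw [mul_comm, ProdRing.mul_idem]
  ext i
  by_cases hi : i = j
  · subst hi; simp
  · simp [hi, a.2 i hi]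

lemma mulIdem_comp_componentProjection_ne_zero (j : ℕ) :
    mulIdem j ≫ componentProjection j ≠ 0 := by
  intro h
  have h₁ : (((1 : ProdRing) * ProdRing.idem j) * ProdRing.idem j) j = 0 :=
    congrFun (congrArg Subtype.val (congrArg (fun φ => φ (1 : ProdRing)) h)) j
  simp [ProdRing.idem] at h₁

variable [HasDerivedCategory.{w} (ModuleCat.{0} ProdRing)]

/-- The image of 1 in Hⁿ(X) is fixed by some `e` of finite support; any `j` beyond the support has
e_j e = 0, so e_j annihilates that image. -/
lemma exists_mulIdem_comp_eq_zero {n : ℤ} {X : DerivedCategory (ModuleCat.{0} ProdRing)}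
    (hX : torsionClass ((homologyFunctor _ n).obj X)) (u : (singleFunctor _ n).obj ringModule ⟶ X) :
    ∃ j, (singleFunctor _ n).map (mulIdem j) ≫ u = 0 := by
  obtain ⟨e, he, h⟩ := (gen_sumIdeal_iff _).1 hX (fromSingle u (1 : ProdRing))
  obtain ⟨j, hj⟩ := eventually_zero_of_mem_sumIdeal he
  refine ⟨j, eq_zero_of_fromSingle_eq_zero _ ?_⟩
  rw [fromSingle_map_comp]
  ext
  have he' : ProdRing.idem j * e = 0 := by
    rw [mul_comm, ProdRing.mul_idem, hj j le_rfl, Pi.single_zero]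
  change fromSingle u ((1 : ProdRing) • ProdRing.idem j) = 0
  have h₁ : (1 : ProdRing) • ProdRing.idem j = ProdRing.idem j • (1 : ProdRing) := by
    rw [one_smul, smul_eq_mul, mul_one]
  rw [h₁]
  refine (map_smul (fromSingle u).hom _ _).trans ?_
  change ProdRing.idem j • fromSingle u (1 : ProdRing) = 0
  rw [← h, smul_smul, he', zero_smul]

lemma singleFunctor_map_mulIdem_comp_ne_zero (n : ℤ) (j : ℕ) :
    (singleFunctor _ n).map (mulIdem j) ≫ (singleFunctor _ n).map (componentProjection j) ≠ 0 := by
  rw [← Functor.map_comp]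
  intro h
  exact mulIdem_comp_componentProjection_ne_zero j
    ((singleFunctor _ n).map_injective (h.trans (Functor.map_zero _ _ _).symm))

theorem not_isCoSmashing_genTilt : ¬ genTilt.IsCoSmashing.{0} := by
  intro h
  let F (j : ℕ) := (singleFunctor (ModuleCat.{0} ProdRing) 0).obj (componentModule j)
  have hF (j : ℕ) : genTilt.le 0 (F j) := ⟨fun i hi => isZero_homology_single _ 0 i hi.ne',
    (gen_isClosedUnderIsomorphisms _).of_iso
      ((singleFunctorCompHomologyFunctorIso _ 0).symm.app _) (torsionClass_componentModule j)⟩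
  have hX : genTilt.le 0 (∏ᶜ F) := by
    rw [← h]
    exact ⟨ℕ, F, Limits.Pi.π F, ⟨productIsProduct F⟩, hF⟩
  obtain ⟨j, hj⟩ := exists_mulIdem_comp_eq_zero hX.2
    (Limits.Pi.lift fun j => (singleFunctor _ 0).map (componentProjection j))
  refine singleFunctor_map_mulIdem_comp_ne_zero.{w} 0 j ?_
  have := congrArg (· ≫ Limits.Pi.π F j) hj
  simpa using this

/-- Only the existence of products and the compatibility of Γ with the projections are used. The
class assembled from the projections R → R_j is pulled back along the diagonal of R. -/
theorem not_isAET4Star_extendedHeart_genTilt :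
    ¬ genTilt.extendedHeart.extriangulated.IsAET4Star.{0} := by
  intro h
  have hP (X : DerivedCategory (ModuleCat.{0} ProdRing)) :
      genTilt.extendedHeart X ↔ genTilt.ge 0 X ∧ genTilt.le 1 X := by
    rw [genTilt.extendedHeart_eq, genTilt.shift_le 1 0 1 rfl]
    rfl
  obtain ⟨hI, Γ, -, -, hΓ⟩ := h ℕ
  have hA : genTilt.extendedHeart ((singleFunctor _ 0).obj ringModule) :=
    (hP _).2 ⟨⟨fun i hi => isZero_homology_single _ 0 i (by lia),
      isTorsionPair_gen.free_of_isZero (isZero_homology_single _ 0 _ (by lia))⟩,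
      fun i hi => isZero_homology_single _ 0 i (by lia),
      isTorsionPair_gen.torsion_of_isZero (isZero_homology_single _ 0 _ (by lia))⟩
  have hB (j : ℕ) : genTilt.extendedHeart ((singleFunctor _ 1).obj (componentModule j)) :=
    (hP _).2 ⟨⟨fun i hi => isZero_homology_single _ 1 i (by lia),
      isTorsionPair_gen.free_of_isZero (isZero_homology_single _ 1 _ (by lia))⟩,
      fun i hi => isZero_homology_single _ 1 i (by lia),
      (gen_isClosedUnderIsomorphisms _).of_iso
        ((singleFunctorCompHomologyFunctorIso _ 1).symm.app _) (torsionClass_componentModule j)⟩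
  let A : genTilt.extendedHeart.FullSubcategoryᵒᵖ := op ⟨_, hA⟩
  let B (j : ℕ) : genTilt.extendedHeart.FullSubcategoryᵒᵖ := op ⟨_, hB j⟩
  let e (j : ℕ) : ((singleFunctor _ 1).obj (componentModule j))⟦(1 : ℤ)⟧ ≅
      (singleFunctor _ 0).obj (componentModule j) :=
    ((singleFunctors (ModuleCat.{0} ProdRing)).shiftIso 1 0 1 rfl).app _
  let η (j : ℕ) : (singleFunctor _ 0).obj ringModule ⟶
      ((singleFunctor _ 1).obj (componentModule j))⟦(1 : ℤ)⟧ :=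
    (singleFunctor _ 0).map (componentProjection j) ≫ (e j).inv
  let γ : (∐ fun _ : ℕ => A).unop.obj ⟶ (∐ B).unop.obj⟦(1 : ℤ)⟧ := Γ B A η
  have hγ (j : ℕ) : γ ≫ (Sigma.ι B j).unop.hom⟦(1 : ℤ)⟧' =
      (Sigma.ι (fun _ : ℕ => A) j).unop.hom ≫ η j := hΓ B A η j
  -- The diagonal from R to its power in the extended heart.
  obtain ⟨u, hu, -⟩ := (genTilt.extendedHeart.isProductIn_sigma fun _ : ℕ => A).2 hA fun _ => 𝟙 _
  have hu' (j : ℕ) : u ≫ (Sigma.ι (fun _ : ℕ => A) j).unop.hom =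
    𝟙 ((singleFunctor _ 0).obj ringModule) := hu j
  -- H⁰ of the suspended product is its H¹, the top homology of an object of the extended heart,
  -- hence in T.
  have hX : torsionClass ((homologyFunctor _ 0).obj ((∐ B).unop.obj⟦(1 : ℤ)⟧)) :=
    (gen_isClosedUnderIsomorphisms _).of_iso (homologyShiftIso (∐ B).unop.obj (zero_add 1))
      ((hP _).1 (∐ B).unop.property).2.2
  obtain ⟨j, hj⟩ := exists_mulIdem_comp_eq_zero hX (u ≫ γ)
  refine singleFunctor_map_mulIdem_comp_ne_zero.{w} 0 j ?_
  have h₁ : (singleFunctor _ 0).map (mulIdem j) ≫ η j = 0 := by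
    have h₂ := congrArg (· ≫ (Sigma.ι B j).unop.hom⟦(1 : ℤ)⟧') hj
    rw [Category.assoc, Category.assoc, hγ, reassoc_of% hu' j, zero_comp] at h₂
    exact h₂
  rw [← cancel_mono (e j).inv, Category.assoc, zero_comp]
  exact h₁

end ProdRingCounterexamples
theorem mainTheorem9 [HasDerivedCategory.{w} (ModuleCat.{0} ProdRing)] :
    IsTorsionPair (Gen (R := ProdRing) sumIdeal) (Gen (R := ProdRing) (ProdRing ⧸ sumIdeal)) ∧
    ∃ x : TStructure (DerivedCategory (ModuleCat.{0} ProdRing)),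
      IsHRSTilt (Gen (R := ProdRing) sumIdeal) (Gen (R := ProdRing) (ProdRing ⧸ sumIdeal)) x ∧
      x.heart.extriangulated.IsAET4Star.{0} ∧
      ¬ x.IsCoSmashing.{0} ∧
      x.extendedHeart = x.ge 0 ⊓ (x.le 0).shift (1 : ℤ) ∧
      (x.heart.shift (1 : ℤ)).extriangulated.IsAET4Star.{0} ∧
      ¬ x.extendedHeart.extriangulated.IsAET4Star.{0} := by
  refine ⟨isTorsionPair_gen, genTilt, isTorsionPair_gen.isHRSTilt_tilt,
    isAET4Star_of_iff_genTilt _ 0 fun X => Iff.rfl, not_isCoSmashing_genTilt,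
    genTilt.extendedHeart_eq, isAET4Star_of_iff_genTilt _ 1 fun X => ?_,
    not_isAET4Star_extendedHeart_genTilt⟩
  rw [← genTilt.shift_le 1 0 1 rfl, ← genTilt.shift_ge 1 0 1 rfl]
  rfl
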